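/- Let $0<w\le 1$, let $T^3=\mathbb R^3/\Lambda$ be a flat torus ($\Lambda$ a lattice of full rank in $\mathbb R^3$), let $\Delta$ be its Laplacian (the usual Laplacian of $\mathbb R^3$ on $\Lambda$-periodic functions), and put $\nu=\frac12\,\frac{5+3w}{1+3w}$. A prime denotes $\partial/\partial\eta$. Consider on $(0,\infty)\times T^3$ the equation $$\Phi''+\frac{6(1+w)}{1+3w}\,\frac1\eta\,\Phi'=w\Delta\Phi .\qquad(\ast)$$ (i) Let $\Phi$ be a real-valued smooth solution of $(\ast)$ on $(0,\infty)\times T^3$. Then there exist constants $A,B\in\mathbb R$ and a real-valued smooth solution $W$ on $(0,\infty)\times T^3$ of the flat wave equation $W''=w\Delta W$, with zero spatial average at every time, such that, as $\eta\to\infty$ and uniformly in $x\in T^3$, $$\Phi(\eta,x)=A+W(\eta,x)\,\eta^{-\nu-\frac12}+B\,\eta^{-2\nu}+O\big(\eta^{-\nu-\frac32}\big).$$ This expansion may be differentiated term by term in space as often as desired, with the same order $O(\eta^{-\nu-\frac32})$ of the error, uniformly in $x$ (the implied constant may depend on the solution and on the order of differentiation). (ii) $W$ can be prescribed freely: for every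 real-valued smooth solution $W$ of $W''=w\Delta W$ on $(0,\infty)\times T^3$ with zero spatial average at every time, and for all constants $A,B\in\mathbb R$, there exists a smooth solution $\Phi$ of $(\ast)$ on $(0,\infty)\times T^3$ for which the expansion in (i), together with all its spatial derivatives, holds with these $A$, $B$, $W$. -/

import Mathlib

open Filter Set MeasureTheory
open scoped ContDiff Laplacian

/-- Euclidean three-space, the universal cover of a flat three-torus. -/
abbrev Space3 : Type := EuclideanSpace ℝ (Fin 3)

/-- A smooth real-valued function `u (η, x)` on `(0, ∞) × T³`, where `T³ = ℝ³ / Λ` is the flat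
torus whose lattice `Λ` is spanned over `ℤ` by the basis `b` of `ℝ³`. It is given as a function on
`(0, ∞) × ℝ³` that is `Λ`-periodic in space; its values at times `η ≤ 0` play no role. -/
structure IsSmoothOnTorus (b : Module.Basis (Fin 3) ℝ Space3) (u : ℝ → Space3 → ℝ) : Prop where
  smooth : ContDiffOn ℝ ∞ (fun p : ℝ × Space3 => u p.1 p.2) (Ioi (0 : ℝ) ×ˢ univ)
  periodic : ∀ η : ℝ, 0 < η → ∀ (x : Space3) (i : Fin 3), u η (x + b i) = u η x

/-- Global smooth solutions on `(0, ∞) × T³` of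
`Φ'' + (6 (1 + w) / (1 + 3 w)) η⁻¹ Φ' = w Δ Φ`. -/
structure IsPerturbationSolution (w : ℝ) (b : Module.Basis (Fin 3) ℝ Space3)
    (Φ : ℝ → Space3 → ℝ) : Prop extends IsSmoothOnTorus b Φ where
  equation : ∀ η : ℝ, 0 < η → ∀ x : Space3,
    iteratedDeriv 2 (fun s => Φ s x) η
      + 6 * (1 + w) / (1 + 3 * w) * (1 / η) * deriv (fun s => Φ s x) η
      = w * (Δ (Φ η)) x

/-- Smooth solutions on `(0, ∞) × T³` of the flat wave equation `W'' = w Δ W`. -/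
structure IsFlatWaveSolution (w : ℝ) (b : Module.Basis (Fin 3) ℝ Space3)
    (W : ℝ → Space3 → ℝ) : Prop extends IsSmoothOnTorus b W where
  equation : ∀ η : ℝ, 0 < η → ∀ x : Space3,
    iteratedDeriv 2 (fun s => W s x) η = w * (Δ (W η)) x

/-- The spatial average over the torus vanishes at every time. -/
def HasZeroSpatialMean (b : Module.Basis (Fin 3) ℝ Space3) (W : ℝ → Space3 → ℝ) : Prop :=
  ∀ η : ℝ, 0 < η → ∫ x in ZSpan.fundamentalDomain b, W η x = 0

/-- The exponent `ν = (1/2) (5 + 3 w) / (1 + 3 w)`. -/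
noncomputable def lateTimeExponent (w : ℝ) : ℝ := 1 / 2 * ((5 + 3 * w) / (1 + 3 * w))

/-- As `η → ∞`, uniformly in `x`,
`Φ = A + W η ^ (-ν - 1/2) + B η ^ (-2 ν) + O(η ^ (-ν - 3/2))`, and for every `m` the expansion
obtained by taking the `m`-th spatial derivative of each term holds with the same error
(`m = 0` is the expansion itself). -/
def HasLateTimeExpansion (ν : ℝ) (Φ : ℝ → Space3 → ℝ) (A B : ℝ) (W : ℝ → Space3 → ℝ) : Prop :=
  ∀ m : ℕ, ∃ C : ℝ, ∀ᶠ η : ℝ in atTop, ∀ x : Space3,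
    ‖iteratedFDeriv ℝ m (Φ η) x
      - (iteratedFDeriv ℝ m (fun _ : Space3 => A) x
        + η ^ (-ν - 1 / 2) • iteratedFDeriv ℝ m (W η) x
        + η ^ (-2 * ν) • iteratedFDeriv ℝ m (fun _ : Space3 => B) x)‖
      ≤ C * η ^ (-ν - 3 / 2)

/-! ### Solutions of `h'' = (c / z² - 1) h` asymptotic to exponentials -/

/-! Since `2ν + 1 = 6(1+w)/(1+3w)`, the substitution `u = η^(ν+1/2) Φ` removes the damping term: (∗)
becomes `u'' = w Δu + c η⁻² u` with `c = ν² - 1/4` (`IsPerturbationSolution.rescale`). Such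
solutions are studied one Fourier mode at a time.

The mean of `u` solves the Euler equation `f'' = c η⁻² f`, so it is a combination of `η^(ν+1/2)` and
`η^(-ν+1/2)`; after undoing the substitution these are `A` and `B η^(-2ν)`. A mode of frequency `ω >
0` is a combination of `h(ωη)` and its conjugate, where `h'' = (c/z² - 1) h` and `h(z) = e^{iz} +
O(1/z)`. This `h` is built by Picard iteration from infinity (`exists_outgoing_modeFunction`); its
Wronskian with its conjugate is `-2i`, so the two are independent and the amplitudes are explicit in
the data at `η = 1` (`eq_combination_of_modeEquation`).

Replacing `h` by `e^{iz}` and keeping the amplitudes turns the oscillating part of `u` into a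
solution `W` of the flat wave equation. The error in each mode is `O(1/(ωη))`, uniformly over modes
because the nonzero frequencies of a torus are bounded below. The amplitudes of a smooth solution
decay faster than any power, so the errors can be summed after any number of spatial derivatives
(`hasLateTimeExpansion_of_modeSeries`).

Part (ii) is the same correspondence reversed: expand `W` in `e^{±iωη}`, put `h` and its conjugate
in place of the exponentials, and add the homogeneous solutions. -/

theorem hasDerivAt_integral_Ioi {G : ℝ → ℂ} (hG : ContinuousOn G (Ioi 0))
    (hint : ∀ z : ℝ, 0 < z → IntegrableOn G (Ioi z)) {z : ℝ} (hz : 0 < z) :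
    HasDerivAt (fun y : ℝ => ∫ s in Ioi y, G s) (-G z) z := by
  have hz2 : 0 < z / 2 := by positivity
  have hcont : ContinuousAt G z := hG.continuousAt (Ioi_mem_nhds hz)
  have hI : IntervalIntegrable G volume (z / 2) z := by
    rw [intervalIntegrable_iff_integrableOn_Ioc_of_le (by linarith)]
    exact (hint _ hz2).mono_set Ioc_subset_Ioi_self
  have h1 : HasDerivAt (fun y : ℝ => ∫ s in (z / 2)..y, G s) (G z) z :=
    intervalIntegral.integral_hasDerivAt_right hI
      (hG.stronglyMeasurableAtFilter isOpen_Ioi _ hz) hcont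
  have h2 : HasDerivAt (fun y : ℝ => (∫ s in Ioi (z / 2), G s) - ∫ s in (z / 2)..y, G s)
      (-G z) z := by
    simpa using h1.const_sub (∫ s in Ioi (z / 2), G s)
  refine h2.congr_of_eventuallyEq ?_
  filter_upwards [Ioi_mem_nhds hz] with y hy
  rw [← intervalIntegral.integral_Ioi_sub_Ioi' (hint _ hz2) (hint _ hy)]
  ring

/-- Successive approximations, from infinity, to the solution asymptotic to `exp (i z)`. -/
noncomputable def hankelTerm (c : ℝ) : ℕ → ℝ → ℂ
  | 0 => fun z => Complex.exp (z * Complex.I)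
  | n + 1 => fun z => ∫ s in Ioi z, (Real.sin (s - z) * (c / s ^ 2) : ℝ) * hankelTerm c n s

/-- Derivatives of the successive approximations. -/
noncomputable def hankelTermDeriv (c : ℝ) : ℕ → ℝ → ℂ
  | 0 => fun z => Complex.I * Complex.exp (z * Complex.I)
  | n + 1 => fun z => -∫ s in Ioi z, (Real.cos (s - z) * (c / s ^ 2) : ℝ) * hankelTerm c n s

/-- The integrand is the derivative of `-(c/s)^(n+1)/(n+1)!`. Each Picard step thus passes to the
next term of the series of `exp(c/z)`, which makes the iteration converge. -/
theorem integral_Ioi_majorant {c : ℝ} (hc : 0 ≤ c) (n : ℕ) {z : ℝ} (hz : 0 < z) :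
    IntegrableOn (fun s : ℝ => c / s ^ 2 * ((c / s) ^ n / n.factorial)) (Ioi z) ∧
      ∫ s in Ioi z, c / s ^ 2 * ((c / s) ^ n / n.factorial) =
        (c / z) ^ (n + 1) / (n + 1).factorial := by
  have hd : ∀ s ∈ Ici z, HasDerivAt (fun s : ℝ => -((c / s) ^ (n + 1) / (n + 1).factorial))
      (c / s ^ 2 * ((c / s) ^ n / n.factorial)) s := by
    intro s hs
    have hs0 : s ≠ 0 := (hz.trans_le hs).ne'
    have h1 : HasDerivAt (fun s : ℝ => c / s) (-c / s ^ 2) s :=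
      ((hasDerivAt_const s c).div (hasDerivAt_id s) hs0).congr_deriv (by simp)
    have h2 := ((h1.pow (n + 1)).div_const ((n + 1).factorial : ℝ)).neg
    refine h2.congr_deriv ?_
    have : ((n + 1).factorial : ℝ) = (n + 1) * n.factorial := by
      push_cast [Nat.factorial_succ]; ring
    rw [this]
    have h3 : (n.factorial : ℝ) ≠ 0 := by positivity
    have h4 : (n + 1 : ℝ) ≠ 0 := by positivity
    push_cast
    field_simp
  have hnn : ∀ s ∈ Ioi z, 0 ≤ c / s ^ 2 * ((c / s) ^ n / n.factorial) := by
    intro s hs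
    have : 0 < s := hz.trans hs
    positivity
  have ht : Tendsto (fun s : ℝ => -((c / s) ^ (n + 1) / (n + 1).factorial)) atTop (nhds 0) := by
    have h1 : Tendsto (fun s : ℝ => c / s) atTop (nhds 0) := tendsto_const_nhds.div_atTop tendsto_id
    simpa using ((h1.pow (n + 1)).div_const ((n + 1).factorial : ℝ)).neg
  have hi := integrableOn_Ioi_deriv_of_nonneg' hd hnn ht
  refine ⟨hi, ?_⟩
  rw [integral_Ioi_of_hasDerivAt_of_tendsto' hd hi ht]
  ring

/-- One Picard step: `u` is the Duhamel integral from infinity for `u'' + u = (c/z²) f`, and `v` is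
its derivative. Starting at infinity makes every correction vanish there, which fixes the outgoing
asymptotics. -/
theorem oscillatory_integral_facts {c : ℝ} (hc : 0 ≤ c) (n : ℕ) {f : ℝ → ℂ}
    (hf : ContinuousOn f (Ioi 0)) (hb : ∀ z : ℝ, 0 < z → ‖f z‖ ≤ (c / z) ^ n / n.factorial)
    {z : ℝ} (hz : 0 < z) :
    let u : ℝ → ℂ := fun z => ∫ s in Ioi z, (Real.sin (s - z) * (c / s ^ 2) : ℝ) * f s
    let v : ℝ → ℂ := fun z => -∫ s in Ioi z, (Real.cos (s - z) * (c / s ^ 2) : ℝ) * f s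
    HasDerivAt u (v z) z ∧ HasDerivAt v ((c / z ^ 2 : ℝ) * f z - u z) z ∧
      ‖u z‖ ≤ (c / z) ^ (n + 1) / (n + 1).factorial ∧
      ‖v z‖ ≤ (c / z) ^ (n + 1) / (n + 1).factorial := by
  intro u v
  have hcs : ContinuousOn (fun s : ℝ => c / s ^ 2) (Ioi 0) :=
    continuousOn_const.div (by fun_prop) fun s hs => by
      have : (0 : ℝ) < s := hs
      positivity
  have key : ∀ T : ℝ → ℝ, Continuous T → (∀ s, |T s| ≤ 1) →
      ContinuousOn (fun s => (T s * (c / s ^ 2) : ℝ) * f s) (Ioi 0) ∧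
      (∀ z : ℝ, 0 < z → IntegrableOn (fun s => ((T s * (c / s ^ 2) : ℝ) : ℂ) * f s) (Ioi z)) ∧
      (∀ z : ℝ, 0 < z → ‖∫ s in Ioi z, ((T s * (c / s ^ 2) : ℝ) : ℂ) * f s‖ ≤
        (c / z) ^ (n + 1) / (n + 1).factorial) := by
    intro T hT hT1
    have hco : ContinuousOn (fun s => ((T s * (c / s ^ 2) : ℝ) : ℂ) * f s) (Ioi 0) :=
      (Complex.continuous_ofReal.comp_continuousOn (hT.continuousOn.mul hcs)).mul hf
    have hle : ∀ z : ℝ, 0 < z → ∀ᵐ s ∂(volume.restrict (Ioi z)),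
        ‖((T s * (c / s ^ 2) : ℝ) : ℂ) * f s‖ ≤ c / s ^ 2 * ((c / s) ^ n / n.factorial) := by
      intro z hz
      refine (ae_restrict_iff' measurableSet_Ioi).2 (Eventually.of_forall fun s hs => ?_)
      have hs0 : 0 < s := hz.trans hs
      rw [norm_mul, Complex.norm_real, Real.norm_eq_abs, abs_mul,
        abs_of_nonneg (a := c / s ^ 2) (by positivity)]
      have : |T s| * (c / s ^ 2) ≤ c / s ^ 2 :=
        mul_le_of_le_one_left (by positivity) (hT1 s)
      exact mul_le_mul this (hb s hs0) (norm_nonneg _) (by positivity)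
    refine ⟨hco, fun z hz => ?_, fun z hz => ?_⟩
    · exact (integral_Ioi_majorant hc n hz).1.mono'
        ((hco.mono (Ioi_subset_Ioi hz.le)).aestronglyMeasurable measurableSet_Ioi) (hle z hz)
    · rw [← (integral_Ioi_majorant hc n hz).2]
      exact norm_integral_le_of_norm_le (integral_Ioi_majorant hc n hz).1 (hle z hz)
  obtain ⟨hsc, hsi, -⟩ := key Real.sin Real.continuous_sin Real.abs_sin_le_one
  obtain ⟨hcc, hci, -⟩ := key Real.cos Real.continuous_cos Real.abs_cos_le_one
  -- The addition formula takes `y` out of the integrand, so differentiating `u` needs only the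
  -- derivative of a tail integral.
  have hu : ∀ y : ℝ, 0 < y → u y =
      Complex.cos y * (∫ s in Ioi y, ((Real.sin s * (c / s ^ 2) : ℝ) : ℂ) * f s)
        - Complex.sin y * ∫ s in Ioi y, ((Real.cos s * (c / s ^ 2) : ℝ) : ℂ) * f s := by
    intro y hy
    rw [← integral_const_mul, ← integral_const_mul,
      ← integral_sub ((hsi y hy).const_mul _) ((hci y hy).const_mul _)]
    refine integral_congr_ae (Eventually.of_forall fun s => ?_)
    simp only [Real.sin_sub]
    push_cast
    ring
  have hv : ∀ y : ℝ, 0 < y → v y =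
      -(Complex.cos y * (∫ s in Ioi y, ((Real.cos s * (c / s ^ 2) : ℝ) : ℂ) * f s)
        + Complex.sin y * ∫ s in Ioi y, ((Real.sin s * (c / s ^ 2) : ℝ) : ℂ) * f s) := by
    intro y hy
    rw [← integral_const_mul, ← integral_const_mul,
      ← integral_add ((hci y hy).const_mul _) ((hsi y hy).const_mul _)]
    refine congrArg Neg.neg (integral_congr_ae (Eventually.of_forall fun s => ?_))
    simp only [Real.cos_sub]
    push_cast
    ring
  have hdS := hasDerivAt_integral_Ioi hsc hsi hz
  have hdC := hasDerivAt_integral_Ioi hcc hci hz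
  have hcos : HasDerivAt (fun y : ℝ => Complex.cos y) (-Complex.sin z) z :=
    (Complex.hasDerivAt_cos z).comp_ofReal
  have hsin : HasDerivAt (fun y : ℝ => Complex.sin y) (Complex.cos z) z :=
    (Complex.hasDerivAt_sin z).comp_ofReal
  have hpyth : Complex.cos z * Complex.cos z + Complex.sin z * Complex.sin z = 1 := by
    have := Complex.cos_sq_add_sin_sq (z : ℂ)
    rw [← this]; ring
  refine ⟨?_, ?_, ?_, ?_⟩
  · have h := (hcos.mul hdS).sub (hsin.mul hdC)
    refine (h.congr_of_eventuallyEq ?_).congr_deriv ?_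
    · filter_upwards [Ioi_mem_nhds hz] with y hy using hu y hy
    · rw [hv z hz]
      push_cast
      ring
  · have h := ((hcos.mul hdC).add (hsin.mul hdS)).neg
    refine (h.congr_of_eventuallyEq ?_).congr_deriv ?_
    · filter_upwards [Ioi_mem_nhds hz] with y hy using hv y hy
    · rw [hu z hz]
      push_cast
      linear_combination (c / z ^ 2 * f z : ℂ) * hpyth
  · exact (key (fun s => Real.sin (s - z)) (by fun_prop) fun s => Real.abs_sin_le_one _).2.2 z hz
  · simp only [v, norm_neg]
    exact (key (fun s => Real.cos (s - z)) (by fun_prop) fun s => Real.abs_cos_le_one _).2.2 z hz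

theorem hasDerivAt_cexp_mul_I (z : ℝ) :
    HasDerivAt (fun z : ℝ => Complex.exp (z * Complex.I))
      (Complex.I * Complex.exp (z * Complex.I)) z := by
  have h := (((hasDerivAt_id (z : ℂ)).mul_const Complex.I).cexp).comp_ofReal
  simpa [mul_comm] using h

theorem hankelTerm_facts {c : ℝ} (hc : 0 ≤ c) (n : ℕ) :
    (∀ z : ℝ, 0 < z → HasDerivAt (hankelTerm c n) (hankelTermDeriv c n z) z) ∧
    (∀ z : ℝ, 0 < z → ‖hankelTerm c n z‖ ≤ (c / z) ^ n / n.factorial) ∧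
    (∀ z : ℝ, 0 < z → ‖hankelTermDeriv c n z‖ ≤ (c / z) ^ n / n.factorial) := by
  induction n with
  | zero =>
    refine ⟨fun z _ => hasDerivAt_cexp_mul_I z, fun z _ => ?_, fun z _ => ?_⟩
    · simp [hankelTerm, Complex.norm_exp_ofReal_mul_I]
    · simp [hankelTermDeriv, Complex.norm_exp_ofReal_mul_I]
  | succ n ih =>
    have hcont : ContinuousOn (hankelTerm c n) (Ioi 0) := fun z hz =>
      (ih.1 z hz).continuousAt.continuousWithinAt
    exact ⟨fun z hz => (oscillatory_integral_facts hc n hcont ih.2.1 hz).1,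
      fun z hz => (oscillatory_integral_facts hc n hcont ih.2.1 hz).2.2.1,
      fun z hz => (oscillatory_integral_facts hc n hcont ih.2.1 hz).2.2.2⟩

theorem hasDerivAt_hankelTermDeriv_zero (c z : ℝ) :
    HasDerivAt (hankelTermDeriv c 0) (-hankelTerm c 0 z) z := by
  refine ((hasDerivAt_cexp_mul_I z).const_mul Complex.I).congr_deriv ?_
  simp only [hankelTerm]
  rw [← mul_assoc, Complex.I_mul_I]
  ring

theorem hasDerivAt_hankelTermDeriv_succ {c : ℝ} (hc : 0 ≤ c) (n : ℕ) {z : ℝ} (hz : 0 < z) :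
    HasDerivAt (hankelTermDeriv c (n + 1))
      ((c / z ^ 2 : ℝ) * hankelTerm c n z - hankelTerm c (n + 1) z) z :=
  (oscillatory_integral_facts hc n (fun z hz =>
    ((hankelTerm_facts hc n).1 z hz).continuousAt.continuousWithinAt)
    (hankelTerm_facts hc n).2.1 hz).2.1

/-- `h` solves `h'' = (c / z² - 1) h` on `(0, ∞)`, has derivative `h₁`, and both are bounded away
from the origin. -/
structure IsModeFunction (c : ℝ) (h h₁ : ℝ → ℂ) : Prop where
  deriv_fst : ∀ z : ℝ, 0 < z → HasDerivAt h (h₁ z) z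
  deriv_snd : ∀ z : ℝ, 0 < z → HasDerivAt h₁ ((c / z ^ 2 - 1 : ℝ) * h z) z
  bound : ∀ δ : ℝ, 0 < δ → ∃ M : ℝ, ∀ z : ℝ, δ ≤ z → ‖h z‖ ≤ M ∧ ‖h₁ z‖ ≤ M

theorem IsModeFunction.conj {c : ℝ} {h h₁ : ℝ → ℂ} (H : IsModeFunction c h h₁) :
    IsModeFunction c (fun z => star (h z)) (fun z => star (h₁ z)) where
  deriv_fst z hz := (H.deriv_fst z hz).star
  deriv_snd z hz := by
    refine (H.deriv_snd z hz).star.congr_deriv ?_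
    simp
  bound δ hδ := by
    obtain ⟨M, hM⟩ := H.bound δ hδ
    exact ⟨M, fun z hz => by simpa using hM z hz⟩

theorem isModeFunction_exp :
    IsModeFunction 0 (fun z : ℝ => Complex.exp (z * Complex.I))
      (fun z : ℝ => Complex.I * Complex.exp (z * Complex.I)) where
  deriv_fst z _ := hasDerivAt_cexp_mul_I z
  deriv_snd z _ := by
    refine (hasDerivAt_hankelTermDeriv_zero 0 z).congr_deriv ?_
    simp [hankelTerm]
  bound δ _ := ⟨1, fun z _ => by simp [Complex.norm_exp_ofReal_mul_I]⟩

/-- The outgoing solution of `h'' = (c / z² - 1) h`. -/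
theorem exists_outgoing_modeFunction {c : ℝ} (hc : 0 ≤ c) :
    ∃ h h₁ : ℝ → ℂ, IsModeFunction c h h₁ ∧ ∀ δ : ℝ, 0 < δ → ∃ M : ℝ, ∀ z : ℝ, δ ≤ z →
      ‖h z - Complex.exp (z * Complex.I)‖ ≤ M / z ∧
      ‖h₁ z - Complex.I * Complex.exp (z * Complex.I)‖ ≤ M / z := by
  have hsum : ∀ x : ℝ, Summable fun n : ℕ => x ^ n / n.factorial := Real.summable_pow_div_factorial
  have hmono : ∀ (n : ℕ) (δ z : ℝ), 0 < δ → δ ≤ z →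
      (c / z) ^ n / n.factorial ≤ (c / δ) ^ n / n.factorial := by
    intro n δ z hδ hz
    have : 0 < z := hδ.trans_le hz
    gcongr
  have hs0 : ∀ z : ℝ, 0 < z → Summable fun n => hankelTerm c n z := fun z hz =>
    Summable.of_norm_bounded (hsum (c / z)) fun n => (hankelTerm_facts hc n).2.1 z hz
  have hs1 : ∀ z : ℝ, 0 < z → Summable fun n => hankelTermDeriv c n z := fun z hz =>
    Summable.of_norm_bounded (hsum (c / z)) fun n => (hankelTerm_facts hc n).2.2 z hz
  have hd1 : ∀ z : ℝ, 0 < z → HasDerivAt (fun z => ∑' n, hankelTerm c n z)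
      (∑' n, hankelTermDeriv c n z) z := by
    intro z hz
    have hz2 : 0 < z / 2 := by positivity
    exact hasDerivAt_tsum_of_isPreconnected (hsum (c / (z / 2))) isOpen_Ioi
      isPreconnected_Ioi (t := Ioi (z / 2))
      (fun n y hy => (hankelTerm_facts hc n).1 y (hz2.trans hy))
      (fun n y hy => ((hankelTerm_facts hc n).2.2 y (hz2.trans hy)).trans
        (hmono n _ _ hz2 (le_of_lt hy)))
      (y₀ := z) (by simp [hz]) (hs0 z hz) (by simp [hz])
  have hd2 : ∀ z : ℝ, 0 < z → HasDerivAt (fun z => ∑' n, hankelTermDeriv c n z)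
      ((c / z ^ 2 - 1 : ℝ) * ∑' n, hankelTerm c n z) z := by
    intro z hz
    have hz2 : 0 < z / 2 := by positivity
    -- Term `0` has its own equation, without potential. In the later ones term `n` is the source
    -- for term `n + 1`; summing restores the potential in front of the whole series.
    have hT : HasDerivAt (fun z => ∑' n, hankelTermDeriv c (n + 1) z)
        (∑' n, ((c / z ^ 2 : ℝ) * hankelTerm c n z - hankelTerm c (n + 1) z)) z := by
      refine hasDerivAt_tsum_of_isPreconnected
        (g' := fun n z => ((c / z ^ 2 : ℝ) * hankelTerm c n z - hankelTerm c (n + 1) z))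
        (((hsum (c / (z / 2))).mul_left (c / (z / 2) ^ 2)).add
          ((summable_nat_add_iff 1).2 (hsum (c / (z / 2)))))
        isOpen_Ioi isPreconnected_Ioi (t := Ioi (z / 2))
        (fun n y hy => hasDerivAt_hankelTermDeriv_succ hc n (hz2.trans hy))
        (fun n y hy => ?_)
        (y₀ := z) (by simp [hz]) ((summable_nat_add_iff 1).2 (hs1 z hz)) (by simp [hz])
      have hy0 : 0 < y := hz2.trans hy
      have hzy : z / 2 ≤ y := le_of_lt hy
      refine (norm_sub_le _ _).trans (add_le_add ?_ ?_)
      · rw [norm_mul, Complex.norm_real, Real.norm_of_nonneg (by positivity)]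
        refine mul_le_mul ?_ (((hankelTerm_facts hc n).2.1 y hy0).trans (hmono n _ _ hz2 hzy))
          (norm_nonneg _) (by positivity)
        gcongr
      · exact ((hankelTerm_facts hc (n + 1)).2.1 y hy0).trans (hmono (n + 1) _ _ hz2 hzy)
    have hA := (hasDerivAt_hankelTermDeriv_zero c z).add hT
    refine (hA.congr_of_eventuallyEq ?_).congr_deriv ?_
    · filter_upwards [Ioi_mem_nhds hz] with y hy
      exact (hs1 y hy).tsum_eq_zero_add
    · have h3 := (hs0 z hz).tsum_eq_zero_add
      rw [((hs0 z hz).mul_left _).tsum_sub ((summable_nat_add_iff 1).2 (hs0 z hz)), tsum_mul_left]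
      push_cast
      linear_combination h3
  -- Every term past the first contains a factor `c/z`; what remains is dominated by the series of
  -- `exp(c/δ)`.
  have htail : ∀ δ : ℝ, 0 < δ → ∃ M : ℝ, ∀ z : ℝ, δ ≤ z →
      ∀ f : ℕ → ℝ → ℂ, (∀ n, ‖f n z‖ ≤ (c / z) ^ n / n.factorial) →
        ‖∑' n, f n z - f 0 z‖ ≤ M / z := by
    intro δ hδ
    refine ⟨c * ∑' n : ℕ, (c / δ) ^ n / n.factorial, fun z hz f hf => ?_⟩
    have hz0 : 0 < z := hδ.trans_le hz
    have hsf : Summable fun n => f n z := Summable.of_norm_bounded (hsum (c / z)) hf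
    rw [hsf.tsum_eq_zero_add, add_sub_cancel_left]
    have hb : ∀ n, ‖f (n + 1) z‖ ≤ c / z * ((c / δ) ^ n / n.factorial) := by
      intro n
      refine (hf (n + 1)).trans ?_
      calc (c / z) ^ (n + 1) / (n + 1).factorial ≤ (c / z) ^ (n + 1) / n.factorial := by
            gcongr
            exact Nat.le_succ n
        _ = c / z * ((c / z) ^ n / n.factorial) := by rw [pow_succ]; ring
        _ ≤ _ := mul_le_mul_of_nonneg_left (hmono n _ _ hδ hz) (by positivity)
    have := tsum_of_norm_bounded ((hsum (c / δ)).hasSum.mul_left (c / z)) hb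
    refine this.trans (le_of_eq ?_)
    ring
  have hasy : ∀ δ : ℝ, 0 < δ → ∃ M : ℝ, ∀ z : ℝ, δ ≤ z →
      ‖∑' n, hankelTerm c n z - Complex.exp (z * Complex.I)‖ ≤ M / z ∧
      ‖∑' n, hankelTermDeriv c n z - Complex.I * Complex.exp (z * Complex.I)‖ ≤ M / z := by
    intro δ hδ
    obtain ⟨M, hM⟩ := htail δ hδ
    exact ⟨M, fun z hz => ⟨
      hM z hz (hankelTerm c) fun n => (hankelTerm_facts hc n).2.1 z (hδ.trans_le hz),
      hM z hz (hankelTermDeriv c) fun n => (hankelTerm_facts hc n).2.2 z (hδ.trans_le hz)⟩⟩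
  refine ⟨fun z => ∑' n, hankelTerm c n z, fun z => ∑' n, hankelTermDeriv c n z,
    ⟨hd1, hd2, fun δ hδ => ?_⟩, hasy⟩
  refine ⟨∑' n : ℕ, (c / δ) ^ n / n.factorial, fun z hz => ⟨?_, ?_⟩⟩
  · exact tsum_of_norm_bounded (hsum (c / δ)).hasSum fun n =>
      ((hankelTerm_facts hc n).2.1 z (hδ.trans_le hz)).trans (hmono n _ _ hδ hz)
  · exact tsum_of_norm_bounded (hsum (c / δ)).hasSum fun n =>
      ((hankelTerm_facts hc n).2.2 z (hδ.trans_le hz)).trans (hmono n _ _ hδ hz)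

theorem eq_of_hasDerivAt_zero_Ioi {f : ℝ → ℂ} (hf : ∀ z : ℝ, 0 < z → HasDerivAt f 0 z)
    {x y : ℝ} (hx : 0 < x) (hy : 0 < y) : f x = f y :=
  isOpen_Ioi.is_const_of_deriv_eq_zero isPreconnected_Ioi
    (fun z hz => (hf z hz).differentiableAt.differentiableWithinAt)
    (fun z hz => (hf z hz).deriv) hx hy

/-- The Wronskian of an outgoing solution and its conjugate. -/
theorem wronskian_outgoing {c : ℝ} {h h₁ : ℝ → ℂ} (H : IsModeFunction c h h₁) {M : ℝ}
    (hM : ∀ z : ℝ, 1 ≤ z → ‖h z - Complex.exp (z * Complex.I)‖ ≤ M / z ∧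
      ‖h₁ z - Complex.I * Complex.exp (z * Complex.I)‖ ≤ M / z) {z : ℝ} (hz : 0 < z) :
    h z * star (h₁ z) - h₁ z * star (h z) = -2 * Complex.I := by
  -- The equation is real and has no first-order term, so the Wronskian of `h` and its conjugate is
  -- constant; its value is read off at infinity.
  have hconst : ∀ z : ℝ, 0 < z → HasDerivAt (fun z => h z * star (h₁ z) - h₁ z * star (h z)) 0 z := by
    intro z hz
    refine (((H.deriv_fst z hz).mul (H.conj.deriv_snd z hz)).sub
      ((H.deriv_snd z hz).mul (H.conj.deriv_fst z hz))).congr_deriv ?_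
    ring
  have h0 : Tendsto (fun z : ℝ => M / z) atTop (nhds 0) := tendsto_const_nhds.div_atTop tendsto_id
  have e0 : Tendsto (fun z => h z - Complex.exp (z * Complex.I)) atTop (nhds 0) :=
    squeeze_zero_norm' ((eventually_ge_atTop 1).mono fun z hz => (hM z hz).1) h0
  have e1 : Tendsto (fun z => h₁ z - Complex.I * Complex.exp (z * Complex.I)) atTop (nhds 0) :=
    squeeze_zero_norm' ((eventually_ge_atTop 1).mono fun z hz => (hM z hz).2) h0
  obtain ⟨K, hK⟩ := H.bound 1 one_pos
  have key : Tendsto (fun z => h z * star (h₁ z) - h₁ z * star (h z) + 2 * Complex.I) atTop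
      (nhds 0) := by
    have hbd : ∀ z : ℝ, 1 ≤ z →
        ‖h z * star (h₁ z) - h₁ z * star (h z) + 2 * Complex.I‖ ≤ (2 + 2 * K) * (M / z) := by
      intro z hz
      obtain ⟨m0, m1⟩ := hM z hz
      obtain ⟨k0, k1⟩ := hK z hz
      set E := Complex.exp (z * Complex.I) with hE
      have nE : ‖E‖ = 1 := Complex.norm_exp_ofReal_mul_I z
      have hEE : E * star E = 1 := by
        rw [Complex.star_def, Complex.mul_conj, Complex.normSq_eq_norm_sq, nE]; simp
      -- Differences of products are telescoped so that each summand contains one small factor; the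
      -- products of exponentials cancel `2i` because `|E| = 1`.
      have hid : h z * star (h₁ z) - h₁ z * star (h z) + 2 * Complex.I =
          (h z - E) * star (h₁ z) + E * star (h₁ z - Complex.I * E)
            - ((h₁ z - Complex.I * E) * star (h z) + Complex.I * E * star (h z - E)) := by
        simp only [star_sub, star_mul', Complex.star_def, Complex.conj_I] at hEE ⊢
        linear_combination (-2 * Complex.I) * hEE
      rw [hid]
      have t1 : ‖(h z - E) * star (h₁ z)‖ ≤ M / z * K := by
        rw [norm_mul, norm_star]
        exact mul_le_mul m0 k1 (norm_nonneg _) ((norm_nonneg _).trans m0)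
      have t2 : ‖E * star (h₁ z - Complex.I * E)‖ ≤ M / z := by
        rw [norm_mul, norm_star, nE, one_mul]; exact m1
      have t3 : ‖(h₁ z - Complex.I * E) * star (h z)‖ ≤ M / z * K := by
        rw [norm_mul, norm_star]
        exact mul_le_mul m1 k0 (norm_nonneg _) ((norm_nonneg _).trans m1)
      have t4 : ‖Complex.I * E * star (h z - E)‖ ≤ M / z := by
        rw [norm_mul, norm_star, norm_mul, nE, Complex.norm_I, one_mul, one_mul]; exact m0
      have := norm_sub_le ((h z - E) * star (h₁ z) + E * star (h₁ z - Complex.I * E))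
        ((h₁ z - Complex.I * E) * star (h z) + Complex.I * E * star (h z - E))
      have a1 := norm_add_le ((h z - E) * star (h₁ z)) (E * star (h₁ z - Complex.I * E))
      have a2 := norm_add_le ((h₁ z - Complex.I * E) * star (h z)) (Complex.I * E * star (h z - E))
      linarith
    have := h0.const_mul (2 + 2 * K)
    rw [mul_zero] at this
    exact squeeze_zero_norm' ((eventually_ge_atTop 1).mono hbd) this
  have hlim : Tendsto (fun _ : ℝ => h z * star (h₁ z) - h₁ z * star (h z) + 2 * Complex.I) atTop
      (nhds 0) := by
    refine key.congr' ((eventually_gt_atTop 0).mono fun y hy => ?_)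
    rw [eq_of_hasDerivAt_zero_Ioi hconst hy hz]
  have := tendsto_nhds_unique hlim tendsto_const_nhds
  linear_combination -this

/-! ### Fourier coefficients of periodic functions on `ℝ³` -/

/-- Periodicity with respect to the lattice spanned by `b`. -/
def IsLatticePeriodic {E : Type*} (b : Module.Basis (Fin 3) ℝ Space3) (f : Space3 → E) : Prop :=
  ∀ (x : Space3) (i : Fin 3), f (x + b i) = f x

/-- The projection of `ℝ³` onto the standard torus given by the coordinates in the basis `b`. -/
noncomputable def torusProj (b : Module.Basis (Fin 3) ℝ Space3) (x : Space3) :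
    UnitAddTorus (Fin 3) := fun i => (b.repr x i : UnitAddCircle)

theorem isOpenQuotientMap_torusProj (b : Module.Basis (Fin 3) ℝ Space3) :
    IsOpenQuotientMap (torusProj b) := by
  have h1 : IsOpenQuotientMap (Pi.map fun (_ : Fin 3) (t : ℝ) => (t : UnitAddCircle)) :=
    IsOpenQuotientMap.piMap fun _ => QuotientAddGroup.isOpenQuotientMap_mk
  exact h1.comp b.equivFunL.toHomeomorph.isOpenQuotientMap

theorem torusProj_add (b : Module.Basis (Fin 3) ℝ Space3) (x y : Space3) :
    torusProj b (x + y) = torusProj b x + torusProj b y := by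
  ext i
  simp [torusProj]

/-- Points with equal projection have coordinates differing by integers, hence differ by a lattice
vector. -/
theorem IsLatticePeriodic.eq_of_torusProj_eq {E : Type*} {b : Module.Basis (Fin 3) ℝ Space3}
    {f : Space3 → E} (hf : IsLatticePeriodic b f) {x y : Space3}
    (h : torusProj b x = torusProj b y) : f x = f y := by
  have h1 : ∀ i, ∃ n : ℤ, b.repr x i = b.repr y i + n := by
    intro i
    have h2 : ((b.repr x i : ℝ) : UnitAddCircle) = (b.repr y i : ℝ) := congrFun h i
    obtain ⟨n, hn⟩ := AddSubgroup.mem_zmultiples_iff.1 (QuotientAddGroup.eq.1 h2.symm)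
    exact ⟨n, by simp only [zsmul_eq_mul, mul_one] at hn; linarith⟩
  choose n hn using h1
  have h3 : x = y + n 0 • b 0 + n 1 • b 1 + n 2 • b 2 := by
    apply b.repr.injective
    ext i
    rw [hn i]
    fin_cases i <;> simp
  have hp : ∀ i, Function.Periodic f (b i) := fun i x => hf x i
  rw [h3, ((hp 2).zsmul (n 2)), ((hp 1).zsmul (n 1)), ((hp 0).zsmul (n 0))]

theorem torusProj_fract (b : Module.Basis (Fin 3) ℝ Space3) (x : Space3) :
    torusProj b (ZSpan.fract b x) = torusProj b x := by
  ext i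
  simp only [torusProj, ZSpan.repr_fract_apply]
  refine QuotientAddGroup.eq.2 (AddSubgroup.mem_zmultiples_iff.2 ⟨⌊b.repr x i⌋, ?_⟩)
  rw [zsmul_eq_mul, mul_one, Int.fract]
  ring

/-- The closed unit cell meets every fibre; this turns local bounds on periodic functions into
global ones. -/
theorem exists_compact_torusProj (b : Module.Basis (Fin 3) ℝ Space3) :
    ∃ K : Set Space3, IsCompact K ∧ ∀ x, ∃ y ∈ K, torusProj b y = torusProj b x := by
  refine ⟨b.equivFunL.symm '' (Icc 0 1), isCompact_Icc.image b.equivFunL.symm.continuous,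
    fun x => ⟨ZSpan.fract b x, ⟨b.equivFunL (ZSpan.fract b x), ⟨fun i => ?_, fun i => ?_⟩, by simp⟩, torusProj_fract b x⟩⟩
  · simp
  · simpa using (Int.fract_lt_one (b.repr x i)).le

/-- The function on the torus induced by a periodic function. -/
noncomputable def torusLift {E : Type*} (b : Module.Basis (Fin 3) ℝ Space3) (f : Space3 → E) :
    UnitAddTorus (Fin 3) → E :=
  fun θ => f (Function.surjInv (isOpenQuotientMap_torusProj b).surjective θ)

theorem torusLift_torusProj {E : Type*} {b : Module.Basis (Fin 3) ℝ Space3} {f : Space3 → E}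
    (hf : IsLatticePeriodic b f) (x : Space3) : torusLift b f (torusProj b x) = f x :=
  hf.eq_of_torusProj_eq (Function.surjInv_eq (isOpenQuotientMap_torusProj b).surjective _)

theorem continuous_torusLift {E : Type*} [TopologicalSpace E]
    {b : Module.Basis (Fin 3) ℝ Space3} {f : Space3 → E}
    (hf : IsLatticePeriodic b f) (hc : Continuous f) : Continuous (torusLift b f) := by
  rw [(isOpenQuotientMap_torusProj b).continuous_comp_iff.symm]
  exact hc.congr fun x => (torusLift_torusProj hf x).symm

/-- The wave covector of the `k`-th Fourier mode. -/
noncomputable def waveCovector (b : Module.Basis (Fin 3) ℝ Space3) (k : Fin 3 → ℤ) :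
    Space3 →L[ℝ] ℝ :=
  (2 * Real.pi) • ∑ i, (k i : ℝ) • (b.coord i).toContinuousLinearMap

theorem waveCovector_apply (b : Module.Basis (Fin 3) ℝ Space3) (k : Fin 3 → ℤ) (v : Space3) :
    waveCovector b k v = 2 * Real.pi * ∑ i, (k i : ℝ) * b.repr v i := by
  simp [waveCovector]

theorem waveCovector_basis (b : Module.Basis (Fin 3) ℝ Space3) (k : Fin 3 → ℤ) (i : Fin 3) :
    waveCovector b k (b i) = 2 * Real.pi * k i := by
  simp [waveCovector_apply, Finsupp.single_apply]

/-- The `k`-th Fourier mode. -/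
noncomputable def planeWave (b : Module.Basis (Fin 3) ℝ Space3) (k : Fin 3 → ℤ) (x : Space3) : ℂ :=
  Complex.exp (waveCovector b k x * Complex.I)

theorem planeWave_eq_mFourier (b : Module.Basis (Fin 3) ℝ Space3) (k : Fin 3 → ℤ) (x : Space3) :
    planeWave b k x = UnitAddTorus.mFourier k (torusProj b x) := by
  simp only [UnitAddTorus.mFourier, torusProj, ContinuousMap.coe_mk, fourier_coe_apply]
  rw [← Complex.exp_sum, planeWave, waveCovector_apply]
  congr 1
  push_cast
  rw [Finset.mul_sum, Finset.sum_mul]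
  refine Finset.sum_congr rfl fun i _ => ?_
  ring

theorem norm_planeWave (b : Module.Basis (Fin 3) ℝ Space3) (k : Fin 3 → ℤ) (x : Space3) :
    ‖planeWave b k x‖ = 1 := Complex.norm_exp_ofReal_mul_I _

theorem planeWave_add (b : Module.Basis (Fin 3) ℝ Space3) (k : Fin 3 → ℤ) (x y : Space3) :
    planeWave b k (x + y) = planeWave b k x * planeWave b k y := by
  simp only [planeWave, map_add]
  rw [← Complex.exp_add]
  push_cast
  ring_nf

theorem planeWave_zero_right (b : Module.Basis (Fin 3) ℝ Space3) (k : Fin 3 → ℤ) :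
    planeWave b k 0 = 1 := by simp [planeWave]

theorem planeWave_zero_left (b : Module.Basis (Fin 3) ℝ Space3) (x : Space3) :
    planeWave b 0 x = 1 := by simp [planeWave, waveCovector_apply]

theorem planeWave_periodic (b : Module.Basis (Fin 3) ℝ Space3) (k : Fin 3 → ℤ) :
    IsLatticePeriodic b (planeWave b k) := by
  intro x i
  rw [planeWave_add]
  have : planeWave b k (b i) = 1 := by
    rw [planeWave, waveCovector_basis, Complex.exp_eq_one_iff]
    exact ⟨k i, by push_cast; ring⟩
  rw [this, mul_one]

theorem continuous_planeWave (b : Module.Basis (Fin 3) ℝ Space3) (k : Fin 3 → ℤ) :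
    Continuous (planeWave b k) := by
  unfold planeWave
  fun_prop

/-- The Haar probability measure on the standard torus. -/
noncomputable abbrev torusMeasure : Measure (UnitAddTorus (Fin 3)) :=
  Measure.pi fun _ => AddCircle.haarAddCircle

/-- Fourier coefficients of a function on `ℝ³` periodic with respect to the lattice of `b`. -/
noncomputable def latticeCoeff (b : Module.Basis (Fin 3) ℝ Space3) (f : Space3 → ℂ)
    (k : Fin 3 → ℤ) : ℂ :=
  ∫ t, UnitAddTorus.mFourier (-k) t • torusLift b f t ∂torusMeasure

theorem integrable_mFourier_mul (k : Fin 3 → ℤ) {F : UnitAddTorus (Fin 3) → ℂ} (hF : Continuous F) :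
    Integrable (fun t => UnitAddTorus.mFourier (-k) t • F t) torusMeasure := by
  have hc : Continuous (fun t => UnitAddTorus.mFourier (-k) t • F t) := by fun_prop
  exact hc.integrable_of_hasCompactSupport (HasCompactSupport.of_compactSpace _)

theorem norm_mFourier_apply (k : Fin 3 → ℤ) (t : UnitAddTorus (Fin 3)) :
    ‖UnitAddTorus.mFourier k t‖ = 1 := by
  simp only [UnitAddTorus.mFourier, fourier_apply, ContinuousMap.coe_mk, norm_prod, Circle.norm_coe,
    Finset.prod_const_one]

theorem mFourier_apply_add (k : Fin 3 → ℤ) (s t : UnitAddTorus (Fin 3)) :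
    UnitAddTorus.mFourier k (s + t) = UnitAddTorus.mFourier k s * UnitAddTorus.mFourier k t := by
  simp [UnitAddTorus.mFourier, fourier_apply, AddCircle.toCircle_add, Finset.prod_mul_distrib]

theorem latticeCoeff_add {b : Module.Basis (Fin 3) ℝ Space3} {f g : Space3 → ℂ}
    (hf : IsLatticePeriodic b f) (hfc : Continuous f) (hg : IsLatticePeriodic b g)
    (hgc : Continuous g) (k : Fin 3 → ℤ) :
    latticeCoeff b (fun x => f x + g x) k = latticeCoeff b f k + latticeCoeff b g k := by
  simp only [latticeCoeff]
  rw [← integral_add (integrable_mFourier_mul k (continuous_torusLift hf hfc))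
    (integrable_mFourier_mul k (continuous_torusLift hg hgc))]
  refine integral_congr_ae (Eventually.of_forall fun t => ?_)
  simp only [torusLift, smul_add]

theorem latticeCoeff_const_mul (b : Module.Basis (Fin 3) ℝ Space3) (a : ℂ) (f : Space3 → ℂ)
    (k : Fin 3 → ℤ) : latticeCoeff b (fun x => a * f x) k = a * latticeCoeff b f k := by
  simp only [latticeCoeff]
  rw [← integral_const_mul]
  refine integral_congr_ae (Eventually.of_forall fun t => ?_)
  simp only [torusLift, smul_eq_mul]
  ring

theorem norm_latticeCoeff_le {b : Module.Basis (Fin 3) ℝ Space3} {f : Space3 → ℂ} {M : ℝ}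
    (hM : ∀ x, ‖f x‖ ≤ M) (k : Fin 3 → ℤ) : ‖latticeCoeff b f k‖ ≤ M := by
  have h := norm_integral_le_of_norm_le_const (μ := torusMeasure)
    (f := fun t => UnitAddTorus.mFourier (-k) t • torusLift b f t) (C := M)
    (Eventually.of_forall fun t => by
      rw [norm_smul, norm_mFourier_apply, one_mul]; exact hM _)
  simpa [latticeCoeff] using h

/-- Invariance of Haar measure. Differentiating this identity in `y` replaces integration by parts
in the computation of derivative multipliers. -/
theorem latticeCoeff_translate {b : Module.Basis (Fin 3) ℝ Space3} {f : Space3 → ℂ}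
    (hf : IsLatticePeriodic b f) (y : Space3) (k : Fin 3 → ℤ) :
    latticeCoeff b (fun x => f (x + y)) k = planeWave b k y * latticeCoeff b f k := by
  have hp : IsLatticePeriodic b (fun x => f (x + y)) := fun x i => by
    simpa only [add_right_comm x (b i) y] using hf (x + y) i
  have hl : ∀ t, torusLift b (fun x => f (x + y)) t = torusLift b f (t + torusProj b y) := by
    intro t
    obtain ⟨x, rfl⟩ := (isOpenQuotientMap_torusProj b).surjective t
    rw [torusLift_torusProj hp, ← torusProj_add, torusLift_torusProj hf]
  simp only [latticeCoeff, hl]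
  rw [← integral_add_right_eq_self
    (fun t => UnitAddTorus.mFourier (-k) t • torusLift b f t) (torusProj b y),
    ← integral_const_mul]
  refine integral_congr_ae (Eventually.of_forall fun t => ?_)
  have h1 : planeWave b k y * UnitAddTorus.mFourier (-k) (torusProj b y) = 1 := by
    rw [planeWave_eq_mFourier, ← UnitAddTorus.mFourier_add]
    simp [UnitAddTorus.mFourier_zero]
  simp only [mFourier_apply_add, smul_eq_mul]
  linear_combination (-(UnitAddTorus.mFourier (-k) t) * torusLift b f (t + torusProj b y)) * h1

/-- Differentiation under the integral: by periodicity, a bound for `g'` on a compact time interval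
times the unit cell is a dominating constant. -/
theorem hasDerivAt_latticeCoeff {b : Module.Basis (Fin 3) ℝ Space3} {U : Set ℝ} (hU : IsOpen U)
    {g g' : ℝ → Space3 → ℂ} (hd : ∀ s ∈ U, ∀ x, HasDerivAt (fun s => g s x) (g' s x) s)
    (hg : ∀ s ∈ U, Continuous (g s)) (hp : ∀ s ∈ U, IsLatticePeriodic b (g s))
    (hg' : ContinuousOn (fun p : ℝ × Space3 => g' p.1 p.2) (U ×ˢ univ))
    (hp' : ∀ s ∈ U, IsLatticePeriodic b (g' s)) (k : Fin 3 → ℤ) {s₀ : ℝ} (hs₀ : s₀ ∈ U) :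
    HasDerivAt (fun s => latticeCoeff b (g s) k) (latticeCoeff b (g' s₀) k) s₀ := by
  obtain ⟨ε, hε, hball⟩ := Metric.nhds_basis_closedBall.mem_iff.1 (hU.mem_nhds hs₀)
  obtain ⟨K, hK, hKr⟩ := exists_compact_torusProj b
  obtain ⟨M, hM⟩ := ((isCompact_closedBall s₀ ε).prod hK).exists_bound_of_continuousOn
    (hg'.mono (prod_mono hball (subset_univ K)))
  have hg's : ∀ s ∈ U, Continuous (g' s) := fun s hs => by
    have : ContinuousOn (fun x : Space3 => g' s x) univ :=
      hg'.comp (f := fun x : Space3 => (s, x)) (by fun_prop) fun x _ => ⟨hs, mem_univ _⟩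
    exact continuousOn_univ.1 this
  have hbd : ∀ s ∈ Metric.closedBall s₀ ε, ∀ x, ‖g' s x‖ ≤ M := by
    intro s hs x
    obtain ⟨y, hy, hyx⟩ := hKr x
    rw [← (hp' s (hball hs)).eq_of_torusProj_eq hyx]
    exact hM (s, y) ⟨hs, hy⟩
  refine (hasDerivAt_integral_of_dominated_loc_of_deriv_le
    (F := fun s t => UnitAddTorus.mFourier (-k) t • torusLift b (g s) t)
    (F' := fun s t => UnitAddTorus.mFourier (-k) t • torusLift b (g' s) t)
    (bound := fun _ => M) (Metric.closedBall_mem_nhds s₀ hε) ?_ ?_ ?_ ?_ ?_ ?_).2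
  · filter_upwards [hU.mem_nhds hs₀] with s hs
    exact (integrable_mFourier_mul k (continuous_torusLift (hp s hs) (hg s hs))).1
  · exact integrable_mFourier_mul k (continuous_torusLift (hp s₀ hs₀) (hg s₀ hs₀))
  · exact (integrable_mFourier_mul k (continuous_torusLift (hp' s₀ hs₀) (hg's s₀ hs₀))).1
  · refine Eventually.of_forall fun t s hs => ?_
    rw [norm_smul, norm_mFourier_apply, one_mul]
    exact hbd s hs _
  · exact integrable_const M
  · exact Eventually.of_forall fun t s hs => (hd s (hball hs) _).const_mul _

/-! ### Rapidly decaying coefficients -/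

/-- Coefficient families on `ℤ³` decaying faster than every power. -/
def IsRapidlyDecaying (a : (Fin 3 → ℤ) → ℂ) : Prop :=
  ∀ N : ℕ, ∃ C : ℝ, ∀ k, ‖a k‖ * (1 + ‖k‖) ^ N ≤ C

/-- The exponent `4` exceeds the rank `3` of the lattice `ℤ³`, viewed inside `ℝ³`. -/
theorem summable_inv_one_add_norm_pow :
    Summable fun k : Fin 3 → ℤ => ((1 + ‖k‖) ^ 4 : ℝ)⁻¹ := by
  let L : Submodule ℤ (Fin 3 → ℝ) := Submodule.span ℤ (Set.range (Pi.basisFun ℝ (Fin 3)))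
  have hmem : ∀ k : Fin 3 → ℤ, (fun i => (k i : ℝ)) ∈ L := by
    intro k
    have h : (fun i => (k i : ℝ)) = ∑ i, k i • Pi.basisFun ℝ (Fin 3) i := by
      ext j
      simp [Finset.sum_apply, Pi.single_apply]
    rw [h]
    exact L.sum_mem fun i _ => L.smul_mem _ (Submodule.subset_span ⟨i, rfl⟩)
  let ι : (Fin 3 → ℤ) → L := fun k => ⟨fun i => (k i : ℝ), hmem k⟩
  have hinj : Function.Injective ι := by
    intro k l h
    ext i
    have : (k i : ℝ) = l i := congrFun (congrArg Subtype.val h) i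
    exact_mod_cast this
  have hnorm : ∀ k, ‖ι k‖ = ‖k‖ := by
    intro k
    show ‖fun i => (k i : ℝ)‖ = ‖k‖
    have h : ∀ i, ‖(k i : ℝ)‖₊ = ‖k i‖₊ := fun i => NNReal.eq (Int.norm_cast_real _)
    simp [Pi.norm_def, h]
  have hrank : Module.finrank ℤ L < 4 := by
    have : Module.finrank ℤ L = Module.finrank ℝ (Fin 3 → ℝ) := ZLattice.rank ℝ L
    rw [this]
    simp
  have hs := (ZLattice.summable_norm_sub_inv_pow (L := L) 4 hrank 0).comp_injective hinj
  refine Summable.of_norm_bounded_eventually hs ?_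
  filter_upwards [(Set.finite_singleton (0 : Fin 3 → ℤ)).compl_mem_cofinite] with k hk
  have hk0 : 0 < ‖k‖ := norm_pos_iff.2 hk
  have h1 : ‖(ι k : Fin 3 → ℝ)‖ = ‖k‖ := hnorm k
  simp only [Function.comp, sub_zero, h1]
  rw [norm_inv, norm_pow, Real.norm_of_nonneg (by positivity), inv_pow]
  gcongr
  linarith

theorem IsRapidlyDecaying.summable {a : (Fin 3 → ℤ) → ℂ} (ha : IsRapidlyDecaying a) (N : ℕ) :
    Summable fun k => ‖a k‖ * (1 + ‖k‖) ^ N := by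
  obtain ⟨C, hC⟩ := ha (N + 4)
  refine Summable.of_nonneg_of_le (fun k => by positivity) (fun k => ?_)
    (summable_inv_one_add_norm_pow.mul_left C)
  rw [← div_eq_mul_inv, le_div_iff₀ (by positivity)]
  refine le_trans (le_of_eq ?_) (hC k)
  rw [pow_add]
  ring

/-- The multiplier is controlled only on the support of `a`. Hence inverse frequencies and profiles
singular at the origin are allowed once the zero mode is absent. -/
theorem IsRapidlyDecaying.mul_of_norm_le {a m : (Fin 3 → ℤ) → ℂ} (ha : IsRapidlyDecaying a)
    {D : ℝ} {M : ℕ} (hm : ∀ k, a k ≠ 0 → ‖m k‖ ≤ D * (1 + ‖k‖) ^ M) :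
    IsRapidlyDecaying fun k => m k * a k := by
  intro N
  obtain ⟨C, hC⟩ := ha (M + N)
  refine ⟨|D| * C, fun k => ?_⟩
  have hC0 : 0 ≤ C := le_trans (by positivity) (hC k)
  by_cases hk : a k = 0
  · simp only [hk, mul_zero, norm_zero, zero_mul]
    positivity
  rw [norm_mul]
  calc ‖m k‖ * ‖a k‖ * (1 + ‖k‖) ^ N ≤ |D| * (1 + ‖k‖) ^ M * ‖a k‖ * (1 + ‖k‖) ^ N := by
        gcongr
        exact (hm k hk).trans (mul_le_mul_of_nonneg_right (le_abs_self D) (by positivity))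
    _ = |D| * (‖a k‖ * (1 + ‖k‖) ^ (M + N)) := by rw [pow_add]; ring
    _ ≤ |D| * C := by gcongr; exact hC k

theorem IsRapidlyDecaying.add {a a' : (Fin 3 → ℤ) → ℂ} (ha : IsRapidlyDecaying a)
    (ha' : IsRapidlyDecaying a') : IsRapidlyDecaying fun k => a k + a' k := by
  intro N
  obtain ⟨C, hC⟩ := ha N
  obtain ⟨C', hC'⟩ := ha' N
  refine ⟨C + C', fun k => ?_⟩
  have : ‖a k + a' k‖ * (1 + ‖k‖) ^ N ≤ (‖a k‖ + ‖a' k‖) * (1 + ‖k‖) ^ N := by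
    gcongr
    exact norm_add_le _ _
  linarith [hC k, hC' k, add_mul ‖a k‖ ‖a' k‖ ((1 + ‖k‖) ^ N)]

/-! ### Directional derivatives and Fourier coefficients -/

/-- Directional derivative. -/
noncomputable def dirDeriv (v : Space3) (f : Space3 → ℂ) : Space3 → ℂ := fun x => fderiv ℝ f x v

theorem contDiff_dirDeriv {f : Space3 → ℂ} (hf : ContDiff ℝ ∞ f) (v : Space3) :
    ContDiff ℝ ∞ (dirDeriv v f) :=
  (hf.fderiv_right (m := ∞) le_rfl).clm_apply contDiff_const

theorem IsLatticePeriodic.dirDeriv {b : Module.Basis (Fin 3) ℝ Space3} {f : Space3 → ℂ}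
    (hf : IsLatticePeriodic b f) (v : Space3) : IsLatticePeriodic b (dirDeriv v f) := by
  intro x i
  have h : (fun y => f (y + b i)) = f := funext fun y => hf y i
  have h2 := fderiv_comp_add_right (𝕜 := ℝ) (f := f) (x := x) (b i)
  rw [h] at h2
  simp only [_root_.dirDeriv, h2]

theorem IsLatticePeriodic.exists_bound {b : Module.Basis (Fin 3) ℝ Space3} {f : Space3 → ℂ}
    (hf : IsLatticePeriodic b f) (hc : Continuous f) : ∃ M, ∀ x, ‖f x‖ ≤ M := by
  obtain ⟨K, hK, hKr⟩ := exists_compact_torusProj b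
  obtain ⟨M, hM⟩ := hK.exists_bound_of_continuousOn hc.continuousOn
  refine ⟨M, fun x => ?_⟩
  obtain ⟨y, hy, hyx⟩ := hKr x
  rw [← hf.eq_of_torusProj_eq hyx]
  exact hM y hy

theorem hasDerivAt_line {f : Space3 → ℂ} (hf : ContDiff ℝ ∞ f) (x v : Space3) (s : ℝ) :
    HasDerivAt (fun s : ℝ => f (x + s • v)) (dirDeriv v f (x + s • v)) s := by
  have h1 : HasDerivAt (fun s : ℝ => x + s • v) v s := by
    simpa using ((hasDerivAt_id s).smul_const v).const_add x
  exact ((hf.differentiable (by simp)) _).hasFDerivAt.comp_hasDerivAt s h1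

/-- The coefficient of the translate by `s • v` is differentiated at `s = 0` in two ways: under the
integral, and through `latticeCoeff_translate`. -/
theorem latticeCoeff_dirDeriv {b : Module.Basis (Fin 3) ℝ Space3} {f : Space3 → ℂ}
    (hp : IsLatticePeriodic b f) (hf : ContDiff ℝ ∞ f) (v : Space3) (k : Fin 3 → ℤ) :
    latticeCoeff b (dirDeriv v f) k = waveCovector b k v * Complex.I * latticeCoeff b f k := by
  have htr : ∀ {g : Space3 → ℂ}, IsLatticePeriodic b g → ∀ s : ℝ,
      IsLatticePeriodic b (fun x => g (x + s • v)) := by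
    intro g hg s x i
    simpa only [add_right_comm x (b i) (s • v)] using hg (x + s • v) i
  have h1 := hasDerivAt_latticeCoeff (b := b) isOpen_univ (g := fun s x => f (x + s • v))
    (g' := fun s x => dirDeriv v f (x + s • v)) (fun s _ x => hasDerivAt_line hf x v s)
    (fun s _ => hf.continuous.comp (by fun_prop)) (fun s _ => htr hp s)
    (((contDiff_dirDeriv hf v).continuous.comp
      (g := dirDeriv v f) (f := fun p : ℝ × Space3 => p.2 + p.1 • v) (by fun_prop)).continuousOn)
    (fun s _ => htr (hp.dirDeriv v) s) k (mem_univ (0 : ℝ))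
  simp only [zero_smul, add_zero, latticeCoeff_translate hp] at h1
  have h2 : HasDerivAt (fun s : ℝ => planeWave b k (s • v)) (waveCovector b k v * Complex.I) 0 := by
    have h3 : HasDerivAt (fun s : ℝ => ((waveCovector b k (s • v) : ℝ) : ℂ))
        (waveCovector b k v : ℝ) 0 := by
      refine HasDerivAt.ofReal_comp ?_
      simpa using (hasDerivAt_id (0 : ℝ)).mul_const (waveCovector b k v)
    simpa [planeWave] using (h3.mul_const Complex.I).cexp
  exact h1.unique (h2.mul_const _)

theorem laplacian_eq_sum_dirDeriv {f : Space3 → ℂ} (hf : ContDiff ℝ ∞ f) (x : Space3) :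
    Δ f x = ∑ i, dirDeriv (EuclideanSpace.basisFun (Fin 3) ℝ i)
      (dirDeriv (EuclideanSpace.basisFun (Fin 3) ℝ i) f) x := by
  rw [InnerProductSpace.laplacian_eq_iteratedFDeriv_orthonormalBasis f
    (EuclideanSpace.basisFun (Fin 3) ℝ)]
  refine Finset.sum_congr rfl fun i _ => ?_
  rw [iteratedFDeriv_two_apply]
  have hd : DifferentiableAt ℝ (fderiv ℝ f) x :=
    (hf.fderiv_right (m := ∞) le_rfl).differentiable (by simp) x
  unfold dirDeriv
  rw [fderiv_clm_apply hd (differentiableAt_const _)]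
  simp

/-- Parseval for the Riesz representative of the covector. -/
theorem sum_waveCovector_sq (b : Module.Basis (Fin 3) ℝ Space3) (k : Fin 3 → ℤ) :
    ∑ i, waveCovector b k (EuclideanSpace.basisFun (Fin 3) ℝ i) ^ 2 = ‖waveCovector b k‖ ^ 2 := by
  set y := (InnerProductSpace.toDual ℝ Space3).symm (waveCovector b k) with hy
  have h1 : ∀ v, waveCovector b k v = inner ℝ y v := fun v => by
    rw [hy, InnerProductSpace.toDual_symm_apply]
  have h2 : ‖waveCovector b k‖ = ‖y‖ := by rw [hy, LinearIsometryEquiv.norm_map]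
  rw [h2, ← (EuclideanSpace.basisFun (Fin 3) ℝ).sum_sq_norm_inner_left y]
  refine Finset.sum_congr rfl fun i _ => ?_
  rw [h1, Real.norm_eq_abs, sq_abs]

theorem latticeCoeff_laplacian {b : Module.Basis (Fin 3) ℝ Space3} {f : Space3 → ℂ}
    (hp : IsLatticePeriodic b f) (hf : ContDiff ℝ ∞ f) (k : Fin 3 → ℤ) :
    latticeCoeff b (Δ f) k = -(‖waveCovector b k‖ ^ 2 : ℝ) * latticeCoeff b f k := by
  have h1 : Δ f = fun x => ∑ i, dirDeriv (EuclideanSpace.basisFun (Fin 3) ℝ i)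
      (dirDeriv (EuclideanSpace.basisFun (Fin 3) ℝ i) f) x :=
    funext fun x => laplacian_eq_sum_dirDeriv hf x
  have h2 : ∀ i, latticeCoeff b (dirDeriv (EuclideanSpace.basisFun (Fin 3) ℝ i)
      (dirDeriv (EuclideanSpace.basisFun (Fin 3) ℝ i) f)) k =
      -(waveCovector b k (EuclideanSpace.basisFun (Fin 3) ℝ i) ^ 2 : ℝ) * latticeCoeff b f k := by
    intro i
    rw [latticeCoeff_dirDeriv (hp.dirDeriv _) (contDiff_dirDeriv hf _), latticeCoeff_dirDeriv hp hf]
    push_cast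
    linear_combination (waveCovector b k (EuclideanSpace.basisFun (Fin 3) ℝ i) ^ 2 *
      latticeCoeff b f k : ℂ) * Complex.I_sq
  have hpp := fun i => (hp.dirDeriv (EuclideanSpace.basisFun (Fin 3) ℝ i)).dirDeriv
    (EuclideanSpace.basisFun (Fin 3) ℝ i)
  have hcc := fun i => (contDiff_dirDeriv (contDiff_dirDeriv hf
    (EuclideanSpace.basisFun (Fin 3) ℝ i)) (EuclideanSpace.basisFun (Fin 3) ℝ i)).continuous
  rw [h1, ← sum_waveCovector_sq]
  simp only [Fin.sum_univ_three]
  have h01 : IsLatticePeriodic b (fun x => dirDeriv (EuclideanSpace.basisFun (Fin 3) ℝ 0)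
      (dirDeriv (EuclideanSpace.basisFun (Fin 3) ℝ 0) f) x +
      dirDeriv (EuclideanSpace.basisFun (Fin 3) ℝ 1)
      (dirDeriv (EuclideanSpace.basisFun (Fin 3) ℝ 1) f) x) :=
    fun x i => congrArg₂ (· + ·) (hpp 0 x i) (hpp 1 x i)
  rw [latticeCoeff_add h01 ((hcc 0).add (hcc 1)) (hpp 2) (hcc 2), latticeCoeff_add (hpp 0) (hcc 0) (hpp 1) (hcc 1), h2, h2, h2]
  push_cast
  ring

/-- `N` derivatives along `b i` multiply the coefficient by `(2π i kᵢ)^N`, while the coefficients of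
the differentiated function stay bounded. -/
theorem isRapidlyDecaying_latticeCoeff {b : Module.Basis (Fin 3) ℝ Space3} {f : Space3 → ℂ}
    (hp : IsLatticePeriodic b f) (hf : ContDiff ℝ ∞ f) : IsRapidlyDecaying (latticeCoeff b f) := by
  intro N
  have h1 : ∀ (i : Fin 3) (n : ℕ), ContDiff ℝ ∞ ((dirDeriv (b i))^[n] f) ∧
      IsLatticePeriodic b ((dirDeriv (b i))^[n] f) ∧ ∀ k,
      latticeCoeff b ((dirDeriv (b i))^[n] f) k =
        (2 * Real.pi * k i * Complex.I) ^ n * latticeCoeff b f k := by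
    intro i n
    induction n with
    | zero => exact ⟨hf, hp, fun k => by simp⟩
    | succ n ih =>
      rw [Function.iterate_succ_apply']
      refine ⟨contDiff_dirDeriv ih.1 _, ih.2.1.dirDeriv _, fun k => ?_⟩
      rw [latticeCoeff_dirDeriv ih.2.1 ih.1, ih.2.2, waveCovector_basis]
      push_cast
      ring
  have h2 : ∀ i : Fin 3, ∃ M : ℝ, ∀ k, |(k i : ℝ)| ^ N * ‖latticeCoeff b f k‖ ≤ M := by
    intro i
    obtain ⟨hc, hpi, hk⟩ := h1 i N
    obtain ⟨M, hM⟩ := hpi.exists_bound hc.continuous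
    refine ⟨M, fun k => ?_⟩
    refine le_trans ?_ (norm_latticeCoeff_le (b := b) hM k)
    rw [hk k, norm_mul, norm_pow]
    gcongr
    rw [norm_mul, norm_mul, norm_mul, Complex.norm_I, mul_one, Complex.norm_intCast,
      Complex.norm_real, Complex.norm_two, Real.norm_of_nonneg Real.pi_pos.le]
    have : (1 : ℝ) ≤ 2 * Real.pi := by linarith [Real.pi_gt_three]
    exact le_mul_of_one_le_left (abs_nonneg _) this
  choose M hM using h2
  obtain ⟨M0, hM0⟩ := hp.exists_bound hf.continuous
  have hMnn : ∀ i, 0 ≤ M i := fun i => le_trans (by positivity) (hM i 0)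
  refine ⟨2 ^ (N - 1) * (M0 + ∑ i, M i), fun k => ?_⟩
  -- The norm on `ℤ³` is the maximum norm, so differentiating along the direction of the largest
  -- coordinate is enough.
  obtain ⟨i, -, hi⟩ := Finset.exists_max_image Finset.univ (fun i => ‖k i‖) Finset.univ_nonempty
  have hki : ‖k‖ ≤ |(k i : ℝ)| := by
    refine (pi_norm_le_iff_of_nonneg (abs_nonneg _)).2 fun j => ?_
    have := hi j (Finset.mem_univ j)
    simpa [Int.norm_eq_abs] using this
  -- Convexity of the power gives `2^(N-1)`; for `N = 0` the truncated exponent gives the constant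
  -- `1`, which still suffices.
  have h3 : (1 + ‖k‖) ^ N ≤ 2 ^ (N - 1) * (1 + |(k i : ℝ)| ^ N) := by
    calc (1 + ‖k‖) ^ N ≤ (1 + |(k i : ℝ)|) ^ N := by gcongr
      _ ≤ 2 ^ (N - 1) * (1 ^ N + |(k i : ℝ)| ^ N) := add_pow_le zero_le_one (abs_nonneg _) N
      _ = _ := by rw [one_pow]
  calc ‖latticeCoeff b f k‖ * (1 + ‖k‖) ^ N
      ≤ ‖latticeCoeff b f k‖ * (2 ^ (N - 1) * (1 + |(k i : ℝ)| ^ N)) := by gcongr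
    _ = 2 ^ (N - 1) * (‖latticeCoeff b f k‖ + |(k i : ℝ)| ^ N * ‖latticeCoeff b f k‖) := by ring
    _ ≤ 2 ^ (N - 1) * (M0 + ∑ i, M i) := by
        gcongr
        · exact norm_latticeCoeff_le hM0 k
        · exact (hM i k).trans (Finset.single_le_sum (fun j _ => hMnn j) (Finset.mem_univ i))

theorem IsRapidlyDecaying.summable_self {a : (Fin 3 → ℤ) → ℂ} (ha : IsRapidlyDecaying a) :
    Summable a := Summable.of_norm (by simpa using ha.summable 0)

theorem hasSum_latticeCoeff {b : Module.Basis (Fin 3) ℝ Space3} {f : Space3 → ℂ}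
    (hp : IsLatticePeriodic b f) (hf : ContDiff ℝ ∞ f) (x : Space3) :
    HasSum (fun k => latticeCoeff b f k * planeWave b k x) (f x) := by
  let F : C(UnitAddTorus (Fin 3), ℂ) := ⟨torusLift b f, continuous_torusLift hp hf.continuous⟩
  have hs : Summable (UnitAddTorus.mFourierCoeff F) :=
    (isRapidlyDecaying_latticeCoeff hp hf).summable_self
  have h := UnitAddTorus.hasSum_mFourier_series_apply_of_summable hs (torusProj b x)
  have hx : F (torusProj b x) = f x := torusLift_torusProj hp x
  rw [hx] at h
  simp only [planeWave_eq_mFourier]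
  exact h

/-! ### Bounds for the wave covectors -/

theorem exists_norm_waveCovector_le (b : Module.Basis (Fin 3) ℝ Space3) :
    ∃ D : ℝ, 0 ≤ D ∧ ∀ k, ‖waveCovector b k‖ ≤ D * (1 + ‖k‖) := by
  refine ⟨2 * Real.pi * ∑ i, ‖(b.coord i).toContinuousLinearMap‖, by positivity, fun k => ?_⟩
  rw [waveCovector, norm_smul, Real.norm_of_nonneg (by positivity), mul_assoc (2 * Real.pi), Finset.sum_mul]
  refine mul_le_mul_of_nonneg_left ?_ (by positivity)
  refine (norm_sum_le _ _).trans (Finset.sum_le_sum fun i _ => ?_)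
  rw [norm_smul, Int.norm_cast_real, mul_comm]
  gcongr
  linarith [norm_le_pi_norm k i]

/-- If `kᵢ ≠ 0`, the covector takes a value of size at least `2π` on `b i`. This spectral gap makes
the error uniform over all modes. -/
theorem exists_le_norm_waveCovector (b : Module.Basis (Fin 3) ℝ Space3) :
    ∃ m : ℝ, 0 < m ∧ ∀ k, k ≠ 0 → m ≤ ‖waveCovector b k‖ := by
  have hS : 0 ≤ ∑ j, ‖b j‖ := by positivity
  refine ⟨2 * Real.pi / (1 + ∑ j, ‖b j‖), by positivity, fun k hk => ?_⟩
  obtain ⟨i, hi⟩ := Function.ne_iff.1 hk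
  rw [div_le_iff₀ (by positivity)]
  have h1 : ‖waveCovector b k (b i)‖ ≤ ‖waveCovector b k‖ * ‖b i‖ :=
    (waveCovector b k).le_opNorm _
  have h2 : (1 : ℝ) ≤ |(k i : ℝ)| := by
    exact_mod_cast Int.one_le_abs hi
  rw [waveCovector_basis, norm_mul, Real.norm_of_nonneg (by positivity : 0 ≤ 2 * Real.pi),
    Real.norm_eq_abs] at h1
  have h3 : ‖b i‖ ≤ 1 + ∑ j, ‖b j‖ := by
    linarith [Finset.single_le_sum (f := fun j => ‖b j‖) (fun j _ => norm_nonneg _)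
      (Finset.mem_univ i)]
  calc 2 * Real.pi ≤ 2 * Real.pi * |(k i : ℝ)| := le_mul_of_one_le_right (by positivity) h2
    _ ≤ ‖waveCovector b k‖ * ‖b i‖ := h1
    _ ≤ _ := by gcongr

/-- The temporal frequency of the `k`-th mode. -/
noncomputable def modeFreq (w : ℝ) (b : Module.Basis (Fin 3) ℝ Space3) (k : Fin 3 → ℤ) : ℝ :=
  √w * ‖waveCovector b k‖

theorem modeFreq_nonneg (w : ℝ) (b : Module.Basis (Fin 3) ℝ Space3) (k : Fin 3 → ℤ) :
    0 ≤ modeFreq w b k := by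
  unfold modeFreq
  positivity

theorem modeFreq_sq {w : ℝ} (hw : 0 < w) (b : Module.Basis (Fin 3) ℝ Space3) (k : Fin 3 → ℤ) :
    modeFreq w b k ^ 2 = w * ‖waveCovector b k‖ ^ 2 := by
  rw [modeFreq, mul_pow, Real.sq_sqrt hw.le]

theorem exists_le_modeFreq {w : ℝ} (hw : 0 < w) (b : Module.Basis (Fin 3) ℝ Space3) :
    ∃ m : ℝ, 0 < m ∧ ∀ k, k ≠ 0 → m ≤ modeFreq w b k := by
  obtain ⟨m, hm, h⟩ := exists_le_norm_waveCovector b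
  exact ⟨√w * m, by positivity, fun k hk => by unfold modeFreq; gcongr; exact h k hk⟩

theorem modeFreq_pos {w : ℝ} (hw : 0 < w) (b : Module.Basis (Fin 3) ℝ Space3) {k : Fin 3 → ℤ}
    (hk : k ≠ 0) : 0 < modeFreq w b k := by
  obtain ⟨m, hm, h⟩ := exists_le_modeFreq hw b
  exact hm.trans_le (h k hk)

/-! ### Superpositions of modes -/

/-- Rapidly decaying families without zero mode. -/
structure IsModeCoeff (a : (Fin 3 → ℤ) → ℂ) : Prop where
  rapid : IsRapidlyDecaying a
  zero : a 0 = 0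

theorem IsModeCoeff.mul_of_norm_le {a m : (Fin 3 → ℤ) → ℂ} (ha : IsModeCoeff a)
    {D : ℝ} {M : ℕ} (hm : ∀ k, k ≠ 0 → ‖m k‖ ≤ D * (1 + ‖k‖) ^ M) :
    IsModeCoeff fun k => m k * a k where
  rapid := ha.rapid.mul_of_norm_le fun k hk => hm k (by rintro rfl; exact hk ha.zero)
  zero := by rw [ha.zero, mul_zero]

theorem IsModeCoeff.add {a a' : (Fin 3 → ℤ) → ℂ} (ha : IsModeCoeff a) (ha' : IsModeCoeff a') :
    IsModeCoeff fun k => a k + a' k where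
  rapid := ha.rapid.add ha'.rapid
  zero := by rw [ha.zero, ha'.zero, add_zero]

theorem IsModeCoeff.waveCovector_mul {a : (Fin 3 → ℤ) → ℂ} (ha : IsModeCoeff a)
    (b : Module.Basis (Fin 3) ℝ Space3) (v : Space3) :
    IsModeCoeff fun k => waveCovector b k v * Complex.I * a k := by
  obtain ⟨D, -, hD⟩ := exists_norm_waveCovector_le b
  refine ha.mul_of_norm_le (m := fun k => waveCovector b k v * Complex.I) (D := D * ‖v‖) (M := 1)
    fun k _ => ?_
  rw [norm_mul, Complex.norm_I, mul_one, Complex.norm_real, pow_one]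
  calc ‖waveCovector b k v‖ ≤ ‖waveCovector b k‖ * ‖v‖ := (waveCovector b k).le_opNorm _
    _ ≤ D * (1 + ‖k‖) * ‖v‖ := by gcongr; exact hD k
    _ = _ := by ring

theorem exists_modeFreq_le (w : ℝ) (b : Module.Basis (Fin 3) ℝ Space3) :
    ∃ D : ℝ, 0 ≤ D ∧ ∀ k, modeFreq w b k ≤ D * (1 + ‖k‖) := by
  obtain ⟨D, hD0, hD⟩ := exists_norm_waveCovector_le b
  refine ⟨√w * D, by positivity, fun k => ?_⟩
  rw [modeFreq, mul_assoc]
  gcongr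
  exact hD k

theorem IsModeCoeff.modeFreq_mul {a : (Fin 3 → ℤ) → ℂ} (ha : IsModeCoeff a) (w : ℝ)
    (b : Module.Basis (Fin 3) ℝ Space3) : IsModeCoeff fun k => modeFreq w b k * a k := by
  obtain ⟨D, -, hD⟩ := exists_modeFreq_le w b
  refine ha.mul_of_norm_le (m := fun k => (modeFreq w b k : ℂ)) (D := D) (M := 1) fun k _ => ?_
  rw [Complex.norm_real, Real.norm_of_nonneg (modeFreq_nonneg w b k), pow_one]
  exact hD k

theorem IsModeCoeff.modeFreq_inv_mul {a : (Fin 3 → ℤ) → ℂ} (ha : IsModeCoeff a) {w : ℝ}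
    (hw : 0 < w) (b : Module.Basis (Fin 3) ℝ Space3) :
    IsModeCoeff fun k => (modeFreq w b k : ℂ)⁻¹ * a k := by
  obtain ⟨m, hm, h⟩ := exists_le_modeFreq hw b
  refine ha.mul_of_norm_le (m := fun k => (modeFreq w b k : ℂ)⁻¹) (D := m⁻¹) (M := 0)
    fun k hk => ?_
  rw [norm_inv, Complex.norm_real, Real.norm_of_nonneg (modeFreq_nonneg w b k), pow_zero, mul_one]
  have := h k hk
  gcongr

/-- A superposition of Fourier modes, with temporal profile `h`. -/
noncomputable def modeSeries (w : ℝ) (b : Module.Basis (Fin 3) ℝ Space3) (h : ℝ → ℂ)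
    (a : (Fin 3 → ℤ) → ℂ) (η : ℝ) (x : Space3) : ℂ :=
  ∑' k, a k * h (modeFreq w b k * η) * planeWave b k x

/-- Boundedness on every half-line `[δ, ∞)` with `δ > 0`. -/
def IsBoundedAway (h : ℝ → ℂ) : Prop := ∀ δ : ℝ, 0 < δ → ∃ M : ℝ, ∀ z : ℝ, δ ≤ z → ‖h z‖ ≤ M

theorem norm_modeTerm_le {w : ℝ} {b : Module.Basis (Fin 3) ℝ Space3} {h : ℝ → ℂ}
    {a : (Fin 3 → ℤ) → ℂ} (ha : a 0 = 0) {η M : ℝ}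
    (hM : ∀ k, k ≠ 0 → ‖h (modeFreq w b k * η)‖ ≤ M) (k : Fin 3 → ℤ) (x : Space3) :
    ‖a k * h (modeFreq w b k * η) * planeWave b k x‖ ≤ M * ‖a k‖ := by
  by_cases hk : k = 0
  · simp [hk, ha]
  · rw [norm_mul, norm_mul, norm_planeWave, mul_one, mul_comm]
    gcongr
    exact hM k hk

/-- The spectral gap keeps `ω η` away from the origin, where `h` may blow up, simultaneously for all
nonzero modes. -/
theorem IsBoundedAway.exists_modeFreq_bound {h : ℝ → ℂ} (hh : IsBoundedAway h) {w : ℝ}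
    (hw : 0 < w) (b : Module.Basis (Fin 3) ℝ Space3) {δ : ℝ} (hδ : 0 < δ) :
    ∃ M, ∀ η, δ ≤ η → ∀ k, k ≠ 0 → ‖h (modeFreq w b k * η)‖ ≤ M := by
  obtain ⟨m, hm, hmk⟩ := exists_le_modeFreq hw b
  obtain ⟨M, hM⟩ := hh (m * δ) (by positivity)
  refine ⟨M, fun η hη k hk => hM _ ?_⟩
  exact mul_le_mul (hmk k hk) hη hδ.le (modeFreq_nonneg w b k)

theorem IsRapidlyDecaying.summable_norm {a : (Fin 3 → ℤ) → ℂ} (ha : IsRapidlyDecaying a) :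
    Summable fun k => ‖a k‖ := by simpa using ha.summable 0

theorem summable_modeTerm {w : ℝ} (hw : 0 < w) (b : Module.Basis (Fin 3) ℝ Space3) {h : ℝ → ℂ}
    (hh : IsBoundedAway h) {a : (Fin 3 → ℤ) → ℂ} (ha : IsModeCoeff a) {η : ℝ} (hη : 0 < η)
    (x : Space3) : Summable fun k => a k * h (modeFreq w b k * η) * planeWave b k x := by
  obtain ⟨M, hM⟩ := hh.exists_modeFreq_bound hw b hη
  exact Summable.of_norm_bounded (ha.rapid.summable_norm.mul_left M)
    fun k => norm_modeTerm_le ha.zero (hM η le_rfl) k x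

/-! ### Smoothness of mode series and the equation they satisfy. -/

/-- The time coordinate as a complex-valued functional. -/
noncomputable def timeForm : ℝ × Space3 →L[ℝ] ℂ :=
  Complex.ofRealCLM.comp (ContinuousLinearMap.fst ℝ ℝ Space3)

/-- The space coordinates as complex-valued functionals. -/
noncomputable def spaceForm (i : Fin 3) : ℝ × Space3 →L[ℝ] ℂ :=
  Complex.ofRealCLM.comp ((EuclideanSpace.proj i).comp (ContinuousLinearMap.snd ℝ ℝ Space3))

theorem timeForm_apply (p : ℝ × Space3) : timeForm p = p.1 := rfl

theorem spaceForm_apply (i : Fin 3) (p : ℝ × Space3) : spaceForm i p = p.2 i := rfl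

theorem waveCovector_eq_sum (b : Module.Basis (Fin 3) ℝ Space3) (k : Fin 3 → ℤ) (v : Space3) :
    waveCovector b k v = ∑ i, v i * waveCovector b k (EuclideanSpace.basisFun (Fin 3) ℝ i) := by
  conv_lhs => rw [← (EuclideanSpace.basisFun (Fin 3) ℝ).sum_repr v]
  simp only [map_sum, map_smul, smul_eq_mul, EuclideanSpace.basisFun_repr]

/-- The derivative is written in four fixed functionals whose coefficients are again mode terms, so
that the derivative of a mode series is expressed by mode series. -/
theorem hasFDerivAt_modeTerm (b : Module.Basis (Fin 3) ℝ Space3) (k : Fin 3 → ℤ)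
    {h : ℝ → ℂ} {h' : ℂ} {om : ℝ} (z : ℂ) {p : ℝ × Space3} (hd : HasDerivAt h h' (om * p.1)) :
    HasFDerivAt (fun p : ℝ × Space3 => z * h (om * p.1) * planeWave b k p.2)
      ((om * z * h' * planeWave b k p.2) • timeForm +
        ∑ i, (waveCovector b k (EuclideanSpace.basisFun (Fin 3) ℝ i) * Complex.I * z *
          h (om * p.1) * planeWave b k p.2) • spaceForm i) p := by
  have h1 : HasFDerivAt (fun p : ℝ × Space3 => h (om * p.1)) _ p :=
    HasFDerivAt.comp p (f := fun p : ℝ × Space3 => om * p.1) hd.hasFDerivAt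
      (hasFDerivAt_fst.const_mul om)
  have h2 : HasFDerivAt (fun p : ℝ × Space3 => ((waveCovector b k p.2 : ℝ) : ℂ))
      (Complex.ofRealCLM.comp ((waveCovector b k).comp (ContinuousLinearMap.snd ℝ ℝ Space3))) p :=
    (Complex.ofRealCLM.comp
      ((waveCovector b k).comp (ContinuousLinearMap.snd ℝ ℝ Space3))).hasFDerivAt
  have h3 : HasFDerivAt (fun p : ℝ × Space3 => planeWave b k p.2) _ p :=
    (h2.mul_const Complex.I).cexp
  refine ((h1.const_mul z).mul h3).congr_fderiv ?_
  refine ContinuousLinearMap.ext fun q => ?_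
  have hq := waveCovector_eq_sum b k q.2
  simp only [_root_.add_apply, _root_.smul_apply, ContinuousLinearMap.comp_apply, timeForm_apply, spaceForm_apply,
    ContinuousLinearMap.coe_snd', Complex.ofRealCLM_apply, smul_eq_mul, hq, Fin.sum_univ_three]
  simp [planeWave]
  ring

/-- Termwise differentiation on the region `η > p.1 / 2`, where the profiles are bounded uniformly
in the mode and rapid decay absorbs the factors `ω` and `κ`. -/
theorem hasFDerivAt_modeSeries {w : ℝ} (hw : 0 < w) (b : Module.Basis (Fin 3) ℝ Space3)
    {h h' : ℝ → ℂ} (hd : ∀ z : ℝ, 0 < z → HasDerivAt h (h' z) z) (hh : IsBoundedAway h)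
    (hh' : IsBoundedAway h') {a : (Fin 3 → ℤ) → ℂ} (ha : IsModeCoeff a) {p : ℝ × Space3}
    (hp : 0 < p.1) :
    HasFDerivAt (fun p : ℝ × Space3 => modeSeries w b h a p.1 p.2)
      (modeSeries w b h' (fun k => modeFreq w b k * a k) p.1 p.2 • timeForm +
        ∑ i, modeSeries w b h (fun k => waveCovector b k (EuclideanSpace.basisFun (Fin 3) ℝ i) *
          Complex.I * a k) p.1 p.2 • spaceForm i) p := by
  have hω := ha.modeFreq_mul w b
  have hκ := fun i => ha.waveCovector_mul b (EuclideanSpace.basisFun (Fin 3) ℝ i)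
  have hp2 : 0 < p.1 / 2 := by positivity
  obtain ⟨M, hM⟩ := hh.exists_modeFreq_bound hw b hp2
  obtain ⟨M', hM'⟩ := hh'.exists_modeFreq_bound hw b hp2
  let f' : (Fin 3 → ℤ) → ℝ × Space3 → ℝ × Space3 →L[ℝ] ℂ := fun k p =>
    (modeFreq w b k * a k * h' (modeFreq w b k * p.1) * planeWave b k p.2) • timeForm +
      ∑ i, (waveCovector b k (EuclideanSpace.basisFun (Fin 3) ℝ i) * Complex.I * a k *
        h (modeFreq w b k * p.1) * planeWave b k p.2) • spaceForm i
  have hsum : HasSum (fun k => f' k p)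
      (modeSeries w b h' (fun k => modeFreq w b k * a k) p.1 p.2 • timeForm +
        ∑ i, modeSeries w b h (fun k => waveCovector b k (EuclideanSpace.basisFun (Fin 3) ℝ i) *
          Complex.I * a k) p.1 p.2 • spaceForm i) :=
    ((summable_modeTerm hw b hh' hω hp p.2).hasSum.smul_const timeForm).add
      (hasSum_sum fun i _ =>
        (summable_modeTerm hw b hh (hκ i) hp p.2).hasSum.smul_const (spaceForm i))
  rw [← hsum.tsum_eq]
  refine hasFDerivAt_tsum_of_isPreconnected (s := Ioi (p.1 / 2) ×ˢ univ) (x₀ := p)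
    (u := fun k => M' * ‖(modeFreq w b k * a k : ℂ)‖ * ‖timeForm‖ +
      ∑ i, M * ‖waveCovector b k (EuclideanSpace.basisFun (Fin 3) ℝ i) * Complex.I * a k‖ *
        ‖spaceForm i‖) (f' := f') ?_ (isOpen_Ioi.prod isOpen_univ)
    (isPreconnected_Ioi.prod isPreconnected_univ) ?_ ?_ ⟨by simp [hp], mem_univ _⟩
    (summable_modeTerm hw b hh ha hp p.2) ⟨by simp [hp], mem_univ _⟩
  · exact ((hω.rapid.summable_norm.mul_left _).mul_right _).add
      (summable_sum fun i _ => ((hκ i).rapid.summable_norm.mul_left _).mul_right _)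
  · rintro k q ⟨hq, -⟩
    have hq0 : 0 < q.1 := hp2.trans hq
    -- For the zero mode the profile is evaluated at `0`, where it need not be differentiable; the
    -- term vanishes because `a 0 = 0`.
    by_cases hk : k = 0
    · subst hk
      have h0 : f' 0 q = 0 := ContinuousLinearMap.ext fun v => by
        simp only [f', ha.zero, mul_zero, zero_mul, _root_.add_apply, _root_.sum_apply,
          _root_.smul_apply, zero_smul, Finset.sum_const_zero, add_zero, _root_.zero_apply]
      have h1 : (fun p : ℝ × Space3 => a 0 * h (modeFreq w b 0 * p.1) * planeWave b 0 p.2) =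
          fun _ => 0 := by
        funext p
        simp [ha.zero]
      rw [h0]
      exact h1 ▸ hasFDerivAt_const (𝕜 := ℝ) (0 : ℂ) q
    · exact hasFDerivAt_modeTerm b k (a k) (hd _ (mul_pos (modeFreq_pos hw b hk) hq0))
  · rintro k q ⟨hq, -⟩
    refine (norm_add_le _ _).trans (add_le_add ?_ ((norm_sum_le _ _).trans
      (Finset.sum_le_sum fun i _ => ?_)))
    · rw [norm_smul]
      gcongr
      exact norm_modeTerm_le (a := fun k => modeFreq w b k * a k) hω.zero (hM' q.1 (le_of_lt hq))
        k q.2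
    · rw [norm_smul]
      gcongr
      exact norm_modeTerm_le (a := fun k => waveCovector b k
        (EuclideanSpace.basisFun (Fin 3) ℝ i) * Complex.I * a k) (hκ i).zero
        (hM q.1 (le_of_lt hq)) k q.2

theorem hasDerivAt_modeSeries {w : ℝ} (hw : 0 < w) (b : Module.Basis (Fin 3) ℝ Space3)
    {h h' : ℝ → ℂ} (hd : ∀ z : ℝ, 0 < z → HasDerivAt h (h' z) z) (hh : IsBoundedAway h)
    (hh' : IsBoundedAway h') {a : (Fin 3 → ℤ) → ℂ} (ha : IsModeCoeff a) {η : ℝ} (hη : 0 < η)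
    (x : Space3) :
    HasDerivAt (fun s => modeSeries w b h a s x)
      (modeSeries w b h' (fun k => modeFreq w b k * a k) η x) η := by
  have h1 := hasFDerivAt_modeSeries hw b hd hh hh' ha (p := (η, x)) hη
  have h2 : HasDerivAt (fun s : ℝ => (s, x)) ((1 : ℝ), (0 : Space3)) η :=
    (hasDerivAt_id η).prodMk (hasDerivAt_const η x)
  refine (h1.comp_hasDerivAt (f := fun s : ℝ => (s, x)) η h2).congr_deriv ?_
  simp [timeForm_apply, spaceForm_apply]

theorem dirDeriv_modeSeries {w : ℝ} (hw : 0 < w) (b : Module.Basis (Fin 3) ℝ Space3)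
    {h h' : ℝ → ℂ} (hd : ∀ z : ℝ, 0 < z → HasDerivAt h (h' z) z) (hh : IsBoundedAway h)
    (hh' : IsBoundedAway h') {a : (Fin 3 → ℤ) → ℂ} (ha : IsModeCoeff a) {η : ℝ} (hη : 0 < η)
    (j : Fin 3) :
    dirDeriv (EuclideanSpace.basisFun (Fin 3) ℝ j) (modeSeries w b h a η) =
      modeSeries w b h (fun k => waveCovector b k (EuclideanSpace.basisFun (Fin 3) ℝ j) *
          Complex.I * a k) η := by
  funext x
  have h1 := hasFDerivAt_modeSeries hw b hd hh hh' ha (p := (η, x)) hη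
  have h2 : HasFDerivAt (fun y : Space3 => (η, y)) (ContinuousLinearMap.inr ℝ ℝ Space3) x :=
    hasFDerivAt_prodMk_right η x
  have h3 := (h1.comp (f := fun y : Space3 => (η, y)) x h2).fderiv
  unfold dirDeriv
  have h4 : (fun p : ℝ × Space3 => modeSeries w b h a p.1 p.2) ∘ (fun y : Space3 => (η, y)) =
    modeSeries w b h a η := rfl
  rw [h4] at h3
  rw [h3]
  simp only [ContinuousLinearMap.comp_apply, ContinuousLinearMap.inr_apply, _root_.add_apply,
    _root_.sum_apply, _root_.smul_apply, timeForm_apply, spaceForm_apply]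
  rw [Finset.sum_eq_single j]
  · simp
  · intro i _ hi
    simp [hi]
  · simp

theorem IsModeFunction.isBoundedAway_fst {c : ℝ} {h h₁ : ℝ → ℂ} (H : IsModeFunction c h h₁) :
    IsBoundedAway h := fun δ hδ => (H.bound δ hδ).imp fun _ hM z hz => (hM z hz).1

theorem IsModeFunction.isBoundedAway_snd {c : ℝ} {h h₁ : ℝ → ℂ} (H : IsModeFunction c h h₁) :
    IsBoundedAway h₁ := fun δ hδ => (H.bound δ hδ).imp fun _ hM z hz => (hM z hz).2

theorem IsModeFunction.isBoundedAway_thd {c : ℝ} {h h₁ : ℝ → ℂ} (H : IsModeFunction c h h₁) :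
    IsBoundedAway (fun z => (c / z ^ 2 - 1 : ℝ) * h z) := by
  intro δ hδ
  obtain ⟨M, hM⟩ := H.bound δ hδ
  refine ⟨(|c| / δ ^ 2 + 1) * M, fun z hz => ?_⟩
  have hz0 : 0 < z := hδ.trans_le hz
  rw [norm_mul, Complex.norm_real, Real.norm_eq_abs]
  refine mul_le_mul ?_ (hM z hz).1 (norm_nonneg _) (by positivity)
  refine (abs_sub _ _).trans ?_
  rw [abs_div, abs_one, abs_of_pos (by positivity : 0 < z ^ 2)]
  gcongr

/-- From `ω (c/(ωη)² - 1) = (c/η²) ω⁻¹ - ω`: the profile `h''` is traded for `h` with new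
coefficients, so no third profile enters the smoothness induction. -/
theorem modeSeries_second {c : ℝ} {h h₁ : ℝ → ℂ} (H : IsModeFunction c h h₁) {w : ℝ}
    (hw : 0 < w) (b : Module.Basis (Fin 3) ℝ Space3) {a : (Fin 3 → ℤ) → ℂ} (ha : IsModeCoeff a)
    {η : ℝ} (hη : 0 < η) (x : Space3) :
    modeSeries w b (fun z => (c / z ^ 2 - 1 : ℝ) * h z) (fun k => modeFreq w b k * a k) η x =
      (c / η ^ 2 : ℝ) * modeSeries w b h (fun k => (modeFreq w b k : ℂ)⁻¹ * a k) η x -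
        modeSeries w b h (fun k => modeFreq w b k * a k) η x := by
  have s1 := summable_modeTerm hw b H.isBoundedAway_fst (ha.modeFreq_inv_mul hw b) hη x
  have s2 := summable_modeTerm hw b H.isBoundedAway_fst (ha.modeFreq_mul w b) hη x
  unfold modeSeries
  rw [← tsum_mul_left, ← (s1.mul_left _).tsum_sub s2]
  refine tsum_congr fun k => ?_
  by_cases hk : k = 0
  · simp [hk, ha.zero]
  · have : (modeFreq w b k : ℂ) ≠ 0 := by exact_mod_cast (modeFreq_pos hw b hk).ne'
    have h2 : (η : ℂ) ≠ 0 := by exact_mod_cast hη.ne'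
    push_cast
    field_simp

/-- The induction treats `h` and `h₁` together and all coefficient families at once, since each
derivative exchanges the profiles and alters the coefficients. -/
theorem contDiffOn_modeSeries_nat {c : ℝ} {h h₁ : ℝ → ℂ} (H : IsModeFunction c h h₁) {w : ℝ}
    (hw : 0 < w) (b : Module.Basis (Fin 3) ℝ Space3) (n : ℕ) :
    ∀ a : (Fin 3 → ℤ) → ℂ, IsModeCoeff a →
      ContDiffOn ℝ n (fun p : ℝ × Space3 => modeSeries w b h a p.1 p.2) (Ioi (0 : ℝ) ×ˢ univ) ∧
      ContDiffOn ℝ n (fun p : ℝ × Space3 => modeSeries w b h₁ a p.1 p.2)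
        (Ioi (0 : ℝ) ×ˢ univ) := by
  have hopen : IsOpen (Ioi (0 : ℝ) ×ˢ (univ : Set Space3)) := isOpen_Ioi.prod isOpen_univ
  have hD1 := fun (a : (Fin 3 → ℤ) → ℂ) (ha : IsModeCoeff a) (p : ℝ × Space3) (hp : 0 < p.1) =>
    hasFDerivAt_modeSeries hw b H.deriv_fst H.isBoundedAway_fst H.isBoundedAway_snd ha hp
  have hD2 := fun (a : (Fin 3 → ℤ) → ℂ) (ha : IsModeCoeff a) (p : ℝ × Space3) (hp : 0 < p.1) =>
    hasFDerivAt_modeSeries hw b H.deriv_snd H.isBoundedAway_snd H.isBoundedAway_thd ha hp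
  induction n with
  | zero =>
    intro a ha
    simp only [Nat.cast_zero, contDiffOn_zero]
    exact ⟨fun p hp => (hD1 a ha p hp.1).continuousAt.continuousWithinAt,
      fun p hp => (hD2 a ha p hp.1).continuousAt.continuousWithinAt⟩
  | succ n ih =>
    intro a ha
    have hω := ha.modeFreq_mul w b
    have hκ := fun i => ha.waveCovector_mul b (EuclideanSpace.basisFun (Fin 3) ℝ i)
    push_cast
    rw [contDiffOn_succ_iff_fderiv_of_isOpen hopen, contDiffOn_succ_iff_fderiv_of_isOpen hopen]
    refine ⟨⟨fun p hp => (hD1 a ha p hp.1).differentiableAt.differentiableWithinAt,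
      by simp, ?_⟩, ⟨fun p hp => (hD2 a ha p hp.1).differentiableAt.differentiableWithinAt,
      by simp, ?_⟩⟩
    · refine ContDiffOn.congr ?_ fun p hp => (hD1 a ha p hp.1).fderiv
      exact ((ih _ hω).2.smul contDiffOn_const).add
        (ContDiffOn.sum fun i _ => (ih _ (hκ i)).1.smul contDiffOn_const)
    · refine ContDiffOn.congr ?_ fun p hp => (hD2 a ha p hp.1).fderiv
      suffices hs : ContDiffOn ℝ n (fun p : ℝ × Space3 => modeSeries w b
          (fun z => (c / z ^ 2 - 1 : ℝ) * h z) (fun k => modeFreq w b k * a k) p.1 p.2)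
          (Ioi (0 : ℝ) ×ˢ univ) from (hs.smul contDiffOn_const).add
        (ContDiffOn.sum fun i _ => (ih _ (hκ i)).2.smul contDiffOn_const)
      refine ContDiffOn.congr ?_ fun p hp => modeSeries_second H hw b ha hp.1 p.2
      refine ContDiffOn.sub (ContDiffOn.mul ?_ (ih _ (ha.modeFreq_inv_mul hw b)).1) (ih _ hω).1
      refine Complex.ofRealCLM.contDiff.comp_contDiffOn (f := fun p : ℝ × Space3 => c / p.1 ^ 2) ?_
      exact contDiffOn_const.div (by fun_prop) fun p hp => pow_ne_zero 2 (ne_of_gt hp.1)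

theorem contDiffOn_modeSeries {c : ℝ} {h h₁ : ℝ → ℂ} (H : IsModeFunction c h h₁) {w : ℝ}
    (hw : 0 < w) (b : Module.Basis (Fin 3) ℝ Space3) {a : (Fin 3 → ℤ) → ℂ} (ha : IsModeCoeff a) :
    ContDiffOn ℝ ∞ (fun p : ℝ × Space3 => modeSeries w b h a p.1 p.2) (Ioi (0 : ℝ) ×ˢ univ) :=
  contDiffOn_infty.2 fun n => (contDiffOn_modeSeries_nat H hw b n a ha).1

theorem modeSeries_periodic (w : ℝ) (b : Module.Basis (Fin 3) ℝ Space3) (h : ℝ → ℂ)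
    (a : (Fin 3 → ℤ) → ℂ) (η : ℝ) : IsLatticePeriodic b (modeSeries w b h a η) := by
  intro x i
  simp only [modeSeries, planeWave_periodic b _ x i]

theorem contDiff_slice {E : Type*} [NormedAddCommGroup E] [NormedSpace ℝ E]
    {u : ℝ → Space3 → E}
    (hu : ContDiffOn ℝ ∞ (fun p : ℝ × Space3 => u p.1 p.2) (Ioi (0 : ℝ) ×ˢ univ)) {η : ℝ}
    (hη : 0 < η) : ContDiff ℝ ∞ (u η) := by
  rw [← contDiffOn_univ]
  exact hu.comp (f := fun x : Space3 => (η, x)) (s := univ) (by fun_prop)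
    fun x _ => ⟨hη, mem_univ _⟩

theorem laplacian_modeSeries {c : ℝ} {h h₁ : ℝ → ℂ} (H : IsModeFunction c h h₁) {w : ℝ}
    (hw : 0 < w) (b : Module.Basis (Fin 3) ℝ Space3) {a : (Fin 3 → ℤ) → ℂ} (ha : IsModeCoeff a)
    {η : ℝ} (hη : 0 < η) (x : Space3) :
    HasSum (fun k => -(‖waveCovector b k‖ ^ 2 : ℝ) *
      (a k * h (modeFreq w b k * η) * planeWave b k x)) (Δ (modeSeries w b h a η) x) := by
  have hκ := fun i => ha.waveCovector_mul b (EuclideanSpace.basisFun (Fin 3) ℝ i)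
  have hκκ := fun i => (hκ i).waveCovector_mul b (EuclideanSpace.basisFun (Fin 3) ℝ i)
  rw [laplacian_eq_sum_dirDeriv (contDiff_slice (contDiffOn_modeSeries H hw b ha) hη)]
  have h1 := hasSum_sum (s := Finset.univ) fun i _ =>
    (summable_modeTerm hw b H.isBoundedAway_fst (hκκ i) hη x).hasSum
  convert h1 using 1
  · funext k
    rw [← sum_waveCovector_sq]
    push_cast
    simp only [Fin.sum_univ_three]
    have := Complex.I_sq
    linear_combination (-a k * h (modeFreq w b k * η) * planeWave b k x *
      ((waveCovector b k (EuclideanSpace.basisFun (Fin 3) ℝ 0)) ^ 2 +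
      (waveCovector b k (EuclideanSpace.basisFun (Fin 3) ℝ 1)) ^ 2 +
      (waveCovector b k (EuclideanSpace.basisFun (Fin 3) ℝ 2)) ^ 2 : ℂ)) * this
  · refine Finset.sum_congr rfl fun i _ => ?_
    rw [dirDeriv_modeSeries hw b H.deriv_fst H.isBoundedAway_fst H.isBoundedAway_snd ha hη,
      dirDeriv_modeSeries hw b H.deriv_fst H.isBoundedAway_fst H.isBoundedAway_snd (hκ i) hη]
    rfl

theorem iteratedDeriv_two_modeSeries {c : ℝ} {h h₁ : ℝ → ℂ} (H : IsModeFunction c h h₁) {w : ℝ}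
    (hw : 0 < w) (b : Module.Basis (Fin 3) ℝ Space3) {a : (Fin 3 → ℤ) → ℂ} (ha : IsModeCoeff a)
    {η : ℝ} (hη : 0 < η) (x : Space3) :
    iteratedDeriv 2 (fun s => modeSeries w b h a s x) η =
      w * Δ (modeSeries w b h a η) x + (c / η ^ 2 : ℝ) * modeSeries w b h a η x := by
  have hω := ha.modeFreq_mul w b
  have h1 : deriv (fun s => modeSeries w b h a s x) =ᶠ[nhds η]
      fun s => modeSeries w b h₁ (fun k => modeFreq w b k * a k) s x := by
    filter_upwards [Ioi_mem_nhds hη] with s hs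
    exact (hasDerivAt_modeSeries hw b H.deriv_fst H.isBoundedAway_fst H.isBoundedAway_snd ha hs
      x).deriv
  have h2 := hasDerivAt_modeSeries hw b H.deriv_snd H.isBoundedAway_snd H.isBoundedAway_thd hω hη x
  rw [show (2 : ℕ) = 1 + 1 from rfl, iteratedDeriv_succ, iteratedDeriv_one, h1.deriv_eq, h2.deriv]
  have s0 := (summable_modeTerm hw b H.isBoundedAway_fst ha hη x).hasSum.mul_left
    ((c / η ^ 2 : ℝ) : ℂ)
  have s1 := ((laplacian_modeSeries H hw b ha hη x).mul_left (w : ℂ)).add s0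
  refine Eq.trans (tsum_congr fun k => ?_) s1.tsum_eq
  by_cases hk : k = 0
  · simp [hk, ha.zero]
  · have h3 : (modeFreq w b k : ℂ) ≠ 0 := by exact_mod_cast (modeFreq_pos hw b hk).ne'
    have h4 : (η : ℂ) ≠ 0 := by exact_mod_cast hη.ne'
    have h5 : (modeFreq w b k : ℂ) ^ 2 = w * ‖waveCovector b k‖ ^ 2 := by
      exact_mod_cast modeFreq_sq hw b k
    -- In the potential term the frequency cancels, so `c/η²` is common to all modes and leaves the
    -- sum.
    have h6 : ((c / (modeFreq w b k * η) ^ 2 - 1 : ℝ) : ℂ) * (modeFreq w b k : ℂ) ^ 2 =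
        (c / η ^ 2 : ℝ) - w * ‖waveCovector b k‖ ^ 2 := by
      rw [← h5]
      push_cast
      field_simp
    push_cast at h6 ⊢
    linear_combination (a k * h (modeFreq w b k * η) * planeWave b k x) * h6

/-! ### Bounds for spatial derivatives, uniform in space. -/

theorem norm_iteratedFDeriv_planeWave_le (b : Module.Basis (Fin 3) ℝ Space3) (k : Fin 3 → ℤ)
    (m : ℕ) (x : Space3) : ‖iteratedFDeriv ℝ m (planeWave b k) x‖ ≤ ‖waveCovector b k‖ ^ m := by
  have hE : ContDiff ℝ ∞ (fun t : ℝ => Complex.exp (t * Complex.I)) :=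
    (Complex.ofRealCLM.contDiff.mul contDiff_const).cexp
  have h0 : ∀ m : ℕ, iteratedDeriv m (fun t : ℝ => Complex.exp (t * Complex.I)) =
      fun t : ℝ => Complex.I ^ m * Complex.exp (t * Complex.I) := by
    intro m
    induction m with
    | zero => simp
    | succ m ih =>
      rw [iteratedDeriv_succ, ih]
      funext t
      rw [((hasDerivAt_cexp_mul_I t).const_mul _).deriv]
      ring
  have h1 : planeWave b k = (fun t : ℝ => Complex.exp (t * Complex.I)) ∘ waveCovector b k := rfl
  rw [h1, (waveCovector b k).iteratedFDeriv_comp_right hE x (i := m) (by exact_mod_cast le_top)]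
  refine (ContinuousMultilinearMap.norm_compContinuousLinearMap_le _ _).trans ?_
  rw [norm_iteratedFDeriv_eq_norm_iteratedDeriv, h0]
  simp [Complex.norm_exp_ofReal_mul_I]

theorem contDiff_planeWave (b : Module.Basis (Fin 3) ℝ Space3) (k : Fin 3 → ℤ) :
    ContDiff ℝ ∞ (planeWave b k) :=
  ((Complex.ofRealCLM.contDiff.comp (waveCovector b k).contDiff).mul contDiff_const).cexp

theorem IsModeCoeff.summable_waveCovector_pow {a : (Fin 3 → ℤ) → ℂ} (ha : IsModeCoeff a)
    (b : Module.Basis (Fin 3) ℝ Space3) (m : ℕ) :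
    Summable fun k => ‖a k‖ * ‖waveCovector b k‖ ^ m := by
  obtain ⟨D, hD0, hD⟩ := exists_norm_waveCovector_le b
  refine Summable.of_nonneg_of_le (fun k => by positivity) (fun k => ?_)
    ((ha.rapid.summable m).mul_left (D ^ m))
  calc ‖a k‖ * ‖waveCovector b k‖ ^ m ≤ ‖a k‖ * (D * (1 + ‖k‖)) ^ m := by
        gcongr
        exact hD k
    _ = _ := by rw [mul_pow]; ring

theorem norm_iteratedFDeriv_modeTerm_le {w : ℝ} (b : Module.Basis (Fin 3) ℝ Space3)
    {g : ℝ → ℂ} {a : (Fin 3 → ℤ) → ℂ} (ha : IsModeCoeff a) {η B : ℝ}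
    (hB : ∀ k, k ≠ 0 → ‖g (modeFreq w b k * η)‖ ≤ B) (m : ℕ) (k : Fin 3 → ℤ) (x : Space3) :
    ‖iteratedFDeriv ℝ m (fun x => a k * g (modeFreq w b k * η) * planeWave b k x) x‖ ≤
      B * (‖a k‖ * ‖waveCovector b k‖ ^ m) := by
  by_cases hk : k = 0
  · subst hk
    simp only [ha.zero, zero_mul, norm_zero, mul_zero]
    rw [iteratedFDeriv_fun_zero]
    simp
  have h1 := iteratedFDeriv_const_smul_apply' (𝕜 := ℝ) (i := m) (x := x)
    (a := a k * g (modeFreq w b k * η)) (f := planeWave b k)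
    ((contDiff_planeWave b k).of_le (by exact_mod_cast le_top)).contDiffAt
  simp only [smul_eq_mul] at h1
  rw [h1, norm_smul, norm_mul]
  calc ‖a k‖ * ‖g (modeFreq w b k * η)‖ * ‖iteratedFDeriv ℝ m (planeWave b k) x‖
      ≤ ‖a k‖ * B * ‖waveCovector b k‖ ^ m := by
        have hB0 := (norm_nonneg _).trans (hB k hk)
        gcongr
        · exact hB k hk
        · exact norm_iteratedFDeriv_planeWave_le b k m x
    _ = _ := by ring

/-- Only the size of the profile at the sampled points matters, not its regularity; hence it applies
directly to `h(z) - e^{iz}`. -/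
theorem norm_iteratedFDeriv_modeSeries_le {w : ℝ} (b : Module.Basis (Fin 3) ℝ Space3)
    {g : ℝ → ℂ} {a : (Fin 3 → ℤ) → ℂ} (ha : IsModeCoeff a) {η B : ℝ}
    (hB : ∀ k, k ≠ 0 → ‖g (modeFreq w b k * η)‖ ≤ B) (m : ℕ) (x : Space3) :
    ‖iteratedFDeriv ℝ m (modeSeries w b g a η) x‖ ≤
      B * ∑' k, ‖a k‖ * ‖waveCovector b k‖ ^ m := by
  have hv : ∀ m : ℕ, Summable fun k => B * (‖a k‖ * ‖waveCovector b k‖ ^ m) :=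
    fun m => (ha.summable_waveCovector_pow b m).mul_left B
  have hb := norm_iteratedFDeriv_modeTerm_le b ha hB
  have h1 := iteratedFDeriv_tsum_apply (N := ⊤)
    (fun _ => contDiff_const.mul (contDiff_planeWave b _)) (fun m _ => hv m)
    (fun m k x _ => hb m k x) (k := m) le_top x
  rw [← tsum_mul_left]
  exact (congrArg norm h1).trans_le (tsum_of_norm_bounded (hv m).hasSum fun k => hb m k x)

/-! ### Spatial averages -/

/-- A translated fundamental domain is again one, and periodic functions have the same integral over
both. -/
theorem setIntegral_fundamentalDomain_translate (b : Module.Basis (Fin 3) ℝ Space3)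
    {f : Space3 → ℂ} (hf : IsLatticePeriodic b f) (y : Space3) :
    ∫ x in ZSpan.fundamentalDomain b, f (x + y) = ∫ x in ZSpan.fundamentalDomain b, f x := by
  have h1 := ZSpan.isAddFundamentalDomain' b (volume : Measure Space3)
  have hinv : ∀ (g : (Submodule.span ℤ (Set.range b)).toAddSubgroup) (x : Space3),
      f (g +ᵥ x) = f x := by
    intro g x
    refine hf.eq_of_torusProj_eq ?_
    rw [← torusProj_fract b (g +ᵥ x), ← torusProj_fract b x]
    exact congrArg _ (ZSpan.fract_zSpan_add b x g.2)
  have : Countable (Submodule.span ℤ (Set.range b)).toAddSubgroup :=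
    inferInstanceAs (Countable (Submodule.span ℤ (Set.range b)))
  have h2 := h1.vadd_of_comm y
  rw [← h2.setIntegral_eq h1 hinv, ← (measurePreserving_add_right volume
    y).setIntegral_preimage_emb (measurableEmbedding_addRight y) f]
  congr 2
  ext x
  simp [Set.mem_vadd_set_iff_neg_vadd_mem]

/-- Translation by half a wavelength along some `b i` with `kᵢ ≠ 0` flips the sign of the plane wave
but preserves its integral. -/
theorem setIntegral_planeWave (b : Module.Basis (Fin 3) ℝ Space3) {k : Fin 3 → ℤ} (hk : k ≠ 0) :
    ∫ x in ZSpan.fundamentalDomain b, planeWave b k x = 0 := by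
  obtain ⟨i, hi⟩ := Function.ne_iff.1 hk
  have hi0 : (k i : ℝ) ≠ 0 := by exact_mod_cast hi
  have h1 := setIntegral_fundamentalDomain_translate b (planeWave_periodic b k)
    ((1 / (2 * k i) : ℝ) • b i)
  have h2 : planeWave b k ((1 / (2 * k i) : ℝ) • b i) = -1 := by
    rw [planeWave, map_smul, waveCovector_basis, smul_eq_mul,
      show (1 / (2 * k i) * (2 * Real.pi * k i) : ℝ) = Real.pi by field_simp, Complex.exp_pi_mul_I]
  simp only [planeWave_add, h2, mul_neg, mul_one, integral_neg] at h1
  exact self_eq_neg.1 h1.symm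

theorem setIntegral_of_hasSum_planeWave (b : Module.Basis (Fin 3) ℝ Space3) {f : Space3 → ℂ}
    {a : (Fin 3 → ℤ) → ℂ} (ha : Summable fun k => ‖a k‖)
    (hf : ∀ x, HasSum (fun k => a k * planeWave b k x) (f x)) :
    ∫ x in ZSpan.fundamentalDomain b, f x =
      (volume (ZSpan.fundamentalDomain b)).toReal * a 0 := by
  have hfin : volume (ZSpan.fundamentalDomain b) < ⊤ :=
    (ZSpan.fundamentalDomain_isBounded b).measure_lt_top
  have : IsFiniteMeasure (volume.restrict (ZSpan.fundamentalDomain b)) := ⟨by simpa using hfin⟩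
  have hint : ∀ k, Integrable (fun x => a k * planeWave b k x)
      (volume.restrict (ZSpan.fundamentalDomain b)) := fun k =>
    Integrable.of_bound (continuous_const.mul (continuous_planeWave b k)).aestronglyMeasurable
      ‖a k‖ (Eventually.of_forall fun x => by rw [norm_mul, norm_planeWave, mul_one])
  have hs : Summable fun k => ∫ x in ZSpan.fundamentalDomain b, ‖a k * planeWave b k x‖ := by
    simp only [norm_mul, norm_planeWave, mul_one, integral_const, smul_eq_mul]
    exact ha.mul_left _
  have h1 := hasSum_integral_of_summable_integral_norm hint hs
  have h2 : HasSum (fun k => ∫ x in ZSpan.fundamentalDomain b, a k * planeWave b k x)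
      ((volume (ZSpan.fundamentalDomain b)).toReal * a 0) := by
    have h3 : ∫ x in ZSpan.fundamentalDomain b, a 0 * planeWave b 0 x =
        (volume (ZSpan.fundamentalDomain b)).toReal * a 0 := by
      simp [planeWave_zero_left, Measure.real]
    rw [← h3]
    refine hasSum_single 0 fun k hk => ?_
    rw [integral_const_mul, setIntegral_planeWave b hk, mul_zero]
  rw [← h1.unique h2]
  exact integral_congr_ae (Eventually.of_forall fun x => (hf x).tsum_eq.symm)

/-! ### Time derivatives and conformally rescaled solutions -/

theorem two_le_infty : (2 : WithTop ℕ∞) ≤ ∞ := WithTop.coe_le_coe.2 (le_top : (2 : ℕ∞) ≤ ⊤)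

theorem IsSmoothOnTorus.exists_timeDeriv {b : Module.Basis (Fin 3) ℝ Space3}
    {u : ℝ → Space3 → ℝ} (hu : IsSmoothOnTorus b u) :
    ∃ u' : ℝ → Space3 → ℝ, IsSmoothOnTorus b u' ∧
      ∀ η : ℝ, 0 < η → ∀ x, HasDerivAt (fun s => u s x) (u' η x) η := by
  have hopen : IsOpen (Ioi (0 : ℝ) ×ˢ (univ : Set Space3)) := isOpen_Ioi.prod isOpen_univ
  have hd : ∀ η : ℝ, 0 < η → ∀ x, HasDerivAt (fun s => u s x)
      (fderiv ℝ (fun p : ℝ × Space3 => u p.1 p.2) (η, x) (1, 0)) η := by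
    intro η hη x
    have h1 : DifferentiableAt ℝ (fun p : ℝ × Space3 => u p.1 p.2) (η, x) :=
      (hu.smooth.contDiffAt (hopen.mem_nhds (x := (η, x)) ⟨hη, mem_univ x⟩)).differentiableAt (by simp)
    have h2 : HasDerivAt (fun s : ℝ => (s, x)) ((1 : ℝ), (0 : Space3)) η :=
      (hasDerivAt_id η).prodMk (hasDerivAt_const η x)
    exact h1.hasFDerivAt.comp_hasDerivAt (f := fun s : ℝ => (s, x)) η h2
  refine ⟨fun η x => fderiv ℝ (fun p : ℝ × Space3 => u p.1 p.2) (η, x) (1, 0), ⟨?_, ?_⟩, hd⟩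
  · exact (hu.smooth.fderiv_of_isOpen hopen (m := ∞) le_rfl).clm_apply contDiffOn_const
  · intro η hη x i
    refine (hd η hη (x + b i)).unique ((hd η hη x).congr_of_eventuallyEq ?_)
    filter_upwards [Ioi_mem_nhds hη] with s hs using hu.periodic s hs x i

theorem iteratedDeriv_two_eq {u u₁ : ℝ → ℝ} {u₂ η : ℝ} (hη : 0 < η)
    (h1 : ∀ s : ℝ, 0 < s → HasDerivAt u (u₁ s) s) (h2 : HasDerivAt u₁ u₂ η) :
    iteratedDeriv 2 u η = u₂ := by
  have h3 : deriv u =ᶠ[nhds η] u₁ := by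
    filter_upwards [Ioi_mem_nhds hη] with s hs using (h1 s hs).deriv
  rw [show (2 : ℕ) = 1 + 1 from rfl, iteratedDeriv_succ, iteratedDeriv_one, h3.deriv_eq, h2.deriv]

/-- Smooth solutions on `(0, ∞) × T³` of `u'' = w Δ u + c η⁻² u`. -/
structure IsConformalSolution (w c : ℝ) (b : Module.Basis (Fin 3) ℝ Space3)
    (u : ℝ → Space3 → ℝ) : Prop extends IsSmoothOnTorus b u where
  equation : ∀ η : ℝ, 0 < η → ∀ x : Space3,
    iteratedDeriv 2 (fun s => u s x) η = w * (Δ (u η)) x + c / η ^ 2 * u η x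

theorem isConformalSolution_zero_iff {w : ℝ} {b : Module.Basis (Fin 3) ℝ Space3}
    {W : ℝ → Space3 → ℝ} : IsConformalSolution w 0 b W ↔ IsFlatWaveSolution w b W := by
  constructor
  · intro h
    exact ⟨h.toIsSmoothOnTorus, fun η hη x => by simpa using h.equation η hη x⟩
  · intro h
    exact ⟨h.toIsSmoothOnTorus, fun η hη x => by simpa using h.equation η hη x⟩

/-- The real part of a superposition of outgoing and incoming modes. -/
noncomputable def realModeSeries (w : ℝ) (b : Module.Basis (Fin 3) ℝ Space3) (h : ℝ → ℂ)
    (α β : (Fin 3 → ℤ) → ℂ) (η : ℝ) (x : Space3) : ℝ :=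
  (modeSeries w b h α η x + modeSeries w b (fun z => star (h z)) β η x).re

theorem isConformalSolution_realModeSeries {c : ℝ} {h h₁ : ℝ → ℂ} (H : IsModeFunction c h h₁)
    {w : ℝ} (hw : 0 < w) (b : Module.Basis (Fin 3) ℝ Space3) {α β : (Fin 3 → ℤ) → ℂ}
    (hα : IsModeCoeff α) (hβ : IsModeCoeff β) :
    IsConformalSolution w c b (realModeSeries w b h α β) := by
  have c1 := contDiffOn_modeSeries H hw b hα
  have c2 := contDiffOn_modeSeries H.conj hw b hβ
  refine ⟨⟨Complex.reCLM.contDiff.comp_contDiffOn (c1.add c2), fun η _ x i => ?_⟩,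
    fun η hη x => ?_⟩
  · simp only [realModeSeries, modeSeries_periodic w b _ _ η x i]
  · have d1 : ContDiffOn ℝ ∞ (fun s => modeSeries w b h α s x) (Ioi 0) :=
      c1.comp (f := fun s : ℝ => (s, x)) (by fun_prop) fun s hs => ⟨hs, mem_univ _⟩
    have d2 : ContDiffOn ℝ ∞ (fun s => modeSeries w b (fun z => star (h z)) β s x) (Ioi 0) :=
      c2.comp (f := fun s : ℝ => (s, x)) (by fun_prop) fun s hs => ⟨hs, mem_univ _⟩
    have e1 : ContDiffAt ℝ 2 (fun s => modeSeries w b h α s x) η :=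
      (d1.contDiffAt (Ioi_mem_nhds hη)).of_le two_le_infty
    have e2 : ContDiffAt ℝ 2 (fun s => modeSeries w b (fun z => star (h z)) β s x) η :=
      (d2.contDiffAt (Ioi_mem_nhds hη)).of_le two_le_infty
    have l1 : ContDiffAt ℝ 2 (modeSeries w b h α η) x :=
      ((contDiff_slice c1 hη).of_le two_le_infty).contDiffAt
    have l2 : ContDiffAt ℝ 2 (modeSeries w b (fun z => star (h z)) β η) x :=
      ((contDiff_slice c2 hη).of_le two_le_infty).contDiffAt
    have t : iteratedDeriv 2 (fun s => realModeSeries w b h α β s x) η =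
        (iteratedDeriv 2 (fun s => modeSeries w b h α s x) η +
          iteratedDeriv 2 (fun s => modeSeries w b (fun z => star (h z)) β s x) η).re := by
      -- On the line the Laplacian is the second derivative, so additivity and commutation with the
      -- real part are obtained from the Laplacian.
      have := (e1.add e2).laplacian_CLM_comp_left (l := Complex.reCLM)
      rw [InnerProductSpace.laplacian_eq_iteratedDeriv_real] at this
      refine Eq.trans this ?_
      refine Eq.trans (congrArg Complex.reCLM (e1.laplacian_add e2)) ?_
      rw [InnerProductSpace.laplacian_eq_iteratedDeriv_real,
        InnerProductSpace.laplacian_eq_iteratedDeriv_real]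
      rfl
    have l : Δ (realModeSeries w b h α β η) x = (Δ (modeSeries w b h α η) x +
        Δ (modeSeries w b (fun z => star (h z)) β η) x).re := by
      refine Eq.trans ((l1.add l2).laplacian_CLM_comp_left (l := Complex.reCLM)) ?_
      exact congrArg Complex.reCLM (l1.laplacian_add l2)
    rw [t, l, iteratedDeriv_two_modeSeries H hw b hα hη, iteratedDeriv_two_modeSeries H.conj hw b
      hβ hη]
    simp only [realModeSeries, Complex.add_re, Complex.re_ofReal_mul]
    ring

theorem integral_realModeSeries {c : ℝ} {h h₁ : ℝ → ℂ} (H : IsModeFunction c h h₁)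
    {w : ℝ} (hw : 0 < w) (b : Module.Basis (Fin 3) ℝ Space3) {α β : (Fin 3 → ℤ) → ℂ}
    (hα : IsModeCoeff α) (hβ : IsModeCoeff β) :
    HasZeroSpatialMean b (realModeSeries w b h α β) := by
  intro η hη
  have hfin : volume (ZSpan.fundamentalDomain b) < ⊤ :=
    (ZSpan.fundamentalDomain_isBounded b).measure_lt_top
  have : IsFiniteMeasure (volume.restrict (ZSpan.fundamentalDomain b)) := ⟨by simpa using hfin⟩
  have key : ∀ {h h₁ : ℝ → ℂ} (H : IsModeFunction c h h₁) {a : (Fin 3 → ℤ) → ℂ}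
      (ha : IsModeCoeff a), Integrable (modeSeries w b h a η)
        (volume.restrict (ZSpan.fundamentalDomain b)) ∧
      ∫ x in ZSpan.fundamentalDomain b, modeSeries w b h a η x = 0 := by
    intro h h₁ H a ha
    have hc := (contDiff_slice (contDiffOn_modeSeries H hw b ha) hη).continuous
    obtain ⟨M, hM⟩ := (modeSeries_periodic w b h a η).exists_bound hc
    refine ⟨Integrable.of_bound hc.aestronglyMeasurable M (Eventually.of_forall hM), ?_⟩
    obtain ⟨M', hM'⟩ := H.isBoundedAway_fst.exists_modeFreq_bound hw b hη
    have hs : Summable fun k => ‖a k * h (modeFreq w b k * η)‖ := by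
      refine Summable.of_nonneg_of_le (fun k => norm_nonneg _) (fun k => ?_)
        (ha.rapid.summable_norm.mul_left M')
      have := norm_modeTerm_le (b := b) ha.zero (hM' η le_rfl) k 0
      rwa [planeWave_zero_right, mul_one] at this
    refine (setIntegral_of_hasSum_planeWave b hs
      fun x => (summable_modeTerm hw b H.isBoundedAway_fst ha hη x).hasSum).trans ?_
    simp [ha.zero]
  obtain ⟨i1, z1⟩ := key H hα
  obtain ⟨i2, z2⟩ := key H.conj hβ
  have h1 := Complex.reCLM.integral_comp_comm (i1.add i2)
  refine Eq.trans h1 ?_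
  simp only [Pi.add_apply]
  rw [integral_add i1 i2, z1, z2]
  simp

/-! ### Expansion of solutions into modes -/

/-- Variation of constants for the mode equation. -/
theorem eq_combination_of_modeEquation {c : ℝ} {h h₁ : ℝ → ℂ} (H : IsModeFunction c h h₁)
    (hW : ∀ z : ℝ, 0 < z → h z * star (h₁ z) - h₁ z * star (h z) = -2 * Complex.I)
    {om : ℝ} (hom : 0 < om) {f f₁ : ℝ → ℂ} (hf : ∀ η : ℝ, 0 < η → HasDerivAt f (f₁ η) η)
    (hf₁ : ∀ η : ℝ, 0 < η → HasDerivAt f₁ ((c / η ^ 2 - om ^ 2 : ℝ) * f η) η)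
    {η : ℝ} (hη : 0 < η) :
    f η = (star (h₁ om) / (-2 * Complex.I) * f 1 +
        star (h om) / (2 * Complex.I) * ((om : ℂ)⁻¹ * f₁ 1)) * h (om * η) +
      (h₁ om / (2 * Complex.I) * f 1 + h om / (-2 * Complex.I) * ((om : ℂ)⁻¹ * f₁ 1)) *
        star (h (om * η)) := by
  have scale : ∀ {g g' : ℝ → ℂ}, (∀ z : ℝ, 0 < z → HasDerivAt g (g' z) z) → ∀ η : ℝ, 0 < η →
      HasDerivAt (fun η => g (om * η)) (om * g' (om * η)) η := by
    intro g g' hg η hη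
    have h1 : HasDerivAt (fun η : ℝ => om * η) om η := by
      simpa using (hasDerivAt_id η).const_mul om
    have := (hg (om * η) (mul_pos hom hη)).scomp η h1
    refine this.congr_deriv ?_
    simp
  have hom' : (om : ℂ) ≠ 0 := by exact_mod_cast hom.ne'
  -- The Wronskian of `f` with a rescaled mode function is constant; its value is taken at `η = 1`.
  have key : ∀ {g g' : ℝ → ℂ}, IsModeFunction c g g' → ∀ η : ℝ, 0 < η →
      f η * (om * g' (om * η)) - f₁ η * g (om * η) = f 1 * (om * g' om) - f₁ 1 * g om := by
    intro g g' G η hη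
    have hz : ∀ η : ℝ, 0 < η → HasDerivAt
        (fun η => f η * (om * g' (om * η)) - f₁ η * g (om * η)) 0 η := by
      intro η hη
      refine (((hf η hη).mul ((scale G.deriv_snd η hη).const_mul _)).sub
        ((hf₁ η hη).mul (scale G.deriv_fst η hη))).congr_deriv ?_
      have hη' : (η : ℂ) ≠ 0 := by exact_mod_cast hη.ne'
      push_cast
      field_simp
      ring
    have := eq_of_hasDerivAt_zero_Ioi hz hη one_pos
    simpa using this
  have k1 := key H.conj η hη
  have k2 := key H η hη
  have k3 := hW (om * η) (mul_pos hom hη)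
  have hI := Complex.I_ne_zero
  -- Cramer's rule: the Wronskians with `h` and with its conjugate determine `f`, the determinant
  -- being `-2i` times the frequency.
  have h4 : (-2 * Complex.I * om) * f η =
      h (om * η) * (f 1 * (om * star (h₁ om)) - f₁ 1 * star (h om)) -
        star (h (om * η)) * (f 1 * (om * h₁ om) - f₁ 1 * h om) := by
    rw [← k1, ← k2, ← k3]
    ring
  have h5 : (-2 * Complex.I * om) ≠ 0 := by simp [hom']
  apply mul_left_cancel₀ h5
  rw [h4]
  field_simp
  ring

/-- Solutions of the Euler equation `f'' = (ν² - 1/4) η⁻² f`. -/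
theorem eq_combination_of_eulerEquation {ν : ℝ} (hν : 0 < ν) {f f₁ : ℝ → ℂ}
    (hf : ∀ η : ℝ, 0 < η → HasDerivAt f (f₁ η) η)
    (hf₁ : ∀ η : ℝ, 0 < η → HasDerivAt f₁ (((ν ^ 2 - 1 / 4) / η ^ 2 : ℝ) * f η) η) :
    ∃ A B : ℂ, ∀ η : ℝ, 0 < η →
      f η = A * (η ^ (ν + 1 / 2) : ℝ) + B * (η ^ (-ν + 1 / 2) : ℝ) := by
  have hpow : ∀ (p η : ℝ), 0 < η → HasDerivAt (fun η : ℝ => ((η ^ p : ℝ) : ℂ))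
      ((p * η ^ (p - 1) : ℝ) : ℂ) η := fun p η hη =>
    (Real.hasDerivAt_rpow_const (Or.inl hη.ne')).ofReal_comp
  -- The same Wronskian argument against `η^p`, a solution when `p(p-1) = ν² - 1/4`, that is for `p
  -- = 1/2 ± ν`.
  have key : ∀ p : ℝ, p * (p - 1) = ν ^ 2 - 1 / 4 → ∀ η : ℝ, 0 < η →
      f η * (p * η ^ (p - 1) : ℝ) - f₁ η * (η ^ p : ℝ) = f 1 * p - f₁ 1 := by
    intro p hp η hη
    have hz : ∀ η : ℝ, 0 < η → HasDerivAt
        (fun η : ℝ => f η * (p * η ^ (p - 1) : ℝ) - f₁ η * (η ^ p : ℝ)) 0 η := by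
      intro η hη
      have h1 : HasDerivAt (fun η : ℝ => ((p * η ^ (p - 1) : ℝ) : ℂ))
          ((p * ((p - 1) * η ^ (p - 1 - 1)) : ℝ) : ℂ) η :=
        ((Real.hasDerivAt_rpow_const (Or.inl hη.ne')).const_mul p).ofReal_comp
      refine (((hf η hη).mul h1).sub ((hf₁ η hη).mul (hpow p η hη))).congr_deriv ?_
      have h2 : p * ((p - 1) * η ^ (p - 1 - 1)) = (ν ^ 2 - 1 / 4) / η ^ 2 * η ^ p := by
        rw [← mul_assoc, hp, Real.rpow_sub_one hη.ne', Real.rpow_sub_one hη.ne']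
        field_simp
      rw [h2]
      push_cast
      ring
    have := eq_of_hasDerivAt_zero_Ioi hz hη one_pos
    simpa using this
  -- The denominator `2ν` is the difference of the two exponents.
  refine ⟨-(f 1 * (-ν + 1 / 2 : ℝ) - f₁ 1) / (2 * ν), (f 1 * (ν + 1 / 2 : ℝ) - f₁ 1) / (2 * ν),
    fun η hη => ?_⟩
  have k1 := key (ν + 1 / 2) (by ring) η hη
  have k2 := key (-ν + 1 / 2) (by ring) η hη
  rw [← k1, ← k2]
  have hν' : (ν : ℂ) ≠ 0 := by exact_mod_cast hν.ne'
  have e1 : ((η ^ (ν + 1 / 2 - 1) : ℝ) : ℂ) * (η ^ (-ν + 1 / 2) : ℝ) = 1 := by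
    rw [← Complex.ofReal_mul, ← Real.rpow_add hη,
      show ν + 1 / 2 - 1 + (-ν + 1 / 2) = (0 : ℝ) by ring, Real.rpow_zero, Complex.ofReal_one]
  have e2 : ((η ^ (-ν + 1 / 2 - 1) : ℝ) : ℂ) * (η ^ (ν + 1 / 2) : ℝ) = 1 := by
    rw [← Complex.ofReal_mul, ← Real.rpow_add hη,
      show -ν + 1 / 2 - 1 + (ν + 1 / 2) = (0 : ℝ) by ring, Real.rpow_zero, Complex.ofReal_one]
  have h5 : (2 * ν : ℂ) ≠ 0 := by simp [hν']
  rw [div_mul_eq_mul_div, div_mul_eq_mul_div, ← add_div, eq_div_iff h5]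
  rw [Complex.ofReal_mul, Complex.ofReal_mul]
  push_cast
  linear_combination (-(f η) * (ν + 1 / 2)) * e1 + (f η * (-ν + 1 / 2)) * e2

theorem IsSmoothOnTorus.contDiff_ofReal {b : Module.Basis (Fin 3) ℝ Space3} {u : ℝ → Space3 → ℝ}
    (hu : IsSmoothOnTorus b u) {η : ℝ} (hη : 0 < η) :
    ContDiff ℝ ∞ (fun x => (u η x : ℂ)) :=
  Complex.ofRealCLM.contDiff.comp (contDiff_slice hu.smooth hη)

theorem IsSmoothOnTorus.periodic_ofReal {b : Module.Basis (Fin 3) ℝ Space3} {u : ℝ → Space3 → ℝ}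
    (hu : IsSmoothOnTorus b u) {η : ℝ} (hη : 0 < η) :
    IsLatticePeriodic b (fun x => (u η x : ℂ)) :=
  fun x i => congrArg _ (hu.periodic η hη x i)

theorem IsSmoothOnTorus.hasDerivAt_latticeCoeff {b : Module.Basis (Fin 3) ℝ Space3}
    {u u' : ℝ → Space3 → ℝ} (hu : IsSmoothOnTorus b u) (hu' : IsSmoothOnTorus b u')
    (hd : ∀ η : ℝ, 0 < η → ∀ x, HasDerivAt (fun s => u s x) (u' η x) η) (k : Fin 3 → ℤ)
    {η : ℝ} (hη : 0 < η) :
    HasDerivAt (fun η => latticeCoeff b (fun x => (u η x : ℂ)) k)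
      (latticeCoeff b (fun x => (u' η x : ℂ)) k) η :=
  _root_.hasDerivAt_latticeCoeff isOpen_Ioi (g := fun η x => (u η x : ℂ))
    (g' := fun η x => (u' η x : ℂ)) (fun s hs x => (hd s hs x).ofReal_comp)
    (fun _ hs => (hu.contDiff_ofReal hs).continuous) (fun _ hs => hu.periodic_ofReal hs)
    (Complex.continuous_ofReal.comp_continuousOn hu'.smooth.continuousOn)
    (fun _ hs => hu'.periodic_ofReal hs) k hη

/-- The Fourier coefficients of a solution obey the mode equation. -/
theorem IsConformalSolution.coeff_equation {w c : ℝ} (hw : 0 < w)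
    {b : Module.Basis (Fin 3) ℝ Space3} {u : ℝ → Space3 → ℝ} (hu : IsConformalSolution w c b u) :
    ∃ u₁ : ℝ → Space3 → ℝ, IsSmoothOnTorus b u₁ ∧ ∀ k, ∀ η : ℝ, 0 < η →
      HasDerivAt (fun η => latticeCoeff b (fun x => (u η x : ℂ)) k)
        (latticeCoeff b (fun x => (u₁ η x : ℂ)) k) η ∧
      HasDerivAt (fun η => latticeCoeff b (fun x => (u₁ η x : ℂ)) k)
        ((c / η ^ 2 - modeFreq w b k ^ 2 : ℝ) * latticeCoeff b (fun x => (u η x : ℂ)) k) η := by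
  have hs := hu.toIsSmoothOnTorus
  obtain ⟨u₁, hs₁, hd₁⟩ := hs.exists_timeDeriv
  obtain ⟨u₂, hs₂, hd₂⟩ := hs₁.exists_timeDeriv
  refine ⟨u₁, hs₁, fun k η hη => ⟨hs.hasDerivAt_latticeCoeff hs₁ hd₁ k hη, ?_⟩⟩
  refine (hs₁.hasDerivAt_latticeCoeff hs₂ hd₂ k hη).congr_deriv ?_
  have hC := hs.contDiff_ofReal hη
  have hP := hs.periodic_ofReal hη
  have hL : ∀ x, Δ (fun x => (u η x : ℂ)) x = (Δ (u η) x : ℝ) := fun x =>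
    ContDiffAt.laplacian_CLM_comp_left (l := Complex.ofRealCLM)
      ((contDiff_slice hs.smooth hη).of_le two_le_infty).contDiffAt
  have h2 : (fun x => (u₂ η x : ℂ)) = fun x => (w : ℂ) * Δ (fun x => (u η x : ℂ)) x +
      (c / η ^ 2 : ℝ) * (u η x : ℂ) := by
    funext x
    rw [hL, ← iteratedDeriv_two_eq hη (fun s hs => hd₁ s hs x) (hd₂ η hη x), hu.equation η hη x]
    push_cast
    ring
  have hΔ : Continuous (Δ (fun x => (u η x : ℂ))) ∧
      IsLatticePeriodic b (Δ (fun x => (u η x : ℂ))) := by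
    have h3 : Δ (fun x => (u η x : ℂ)) = fun x => ∑ i,
        dirDeriv (EuclideanSpace.basisFun (Fin 3) ℝ i)
        (dirDeriv (EuclideanSpace.basisFun (Fin 3) ℝ i) fun x => (u η x : ℂ)) x :=
      funext fun x => laplacian_eq_sum_dirDeriv hC x
    rw [h3]
    exact ⟨continuous_finsetSum _ fun i _ =>
      (contDiff_dirDeriv (contDiff_dirDeriv hC _) _).continuous,
      fun x j => Finset.sum_congr rfl fun i _ => (hP.dirDeriv _).dirDeriv _ x j⟩
  have hP1 : IsLatticePeriodic b fun x => (w : ℂ) * Δ (fun x => (u η x : ℂ)) x :=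
    fun x i => congrArg _ (hΔ.2 x i)
  have hP2 : IsLatticePeriodic b fun x => ((c / η ^ 2 : ℝ) : ℂ) * (u η x : ℂ) :=
    fun x i => congrArg _ (hP x i)
  have hC1 : Continuous fun x => (w : ℂ) * Δ (fun x => (u η x : ℂ)) x :=
    continuous_const.mul hΔ.1
  have hC2 : Continuous fun x => ((c / η ^ 2 : ℝ) : ℂ) * (u η x : ℂ) :=
    continuous_const.mul hC.continuous
  rw [h2, latticeCoeff_add hP1 hC1 hP2 hC2, latticeCoeff_const_mul, latticeCoeff_const_mul, latticeCoeff_laplacian hP hC, modeFreq_sq hw]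
  push_cast
  ring

theorem IsRapidlyDecaying.removeZero {a : (Fin 3 → ℤ) → ℂ} (ha : IsRapidlyDecaying a) :
    IsModeCoeff fun k => if k = 0 then 0 else a k where
  rapid N := by
    obtain ⟨C, hC⟩ := ha N
    refine ⟨C, fun k => ?_⟩
    beta_reduce
    split_ifs with h
    · exact le_trans (by simp only [norm_zero, zero_mul]; positivity) (hC k)
    · exact hC k
  zero := by simp

theorem IsModeCoeff.profile_mul {a : (Fin 3 → ℤ) → ℂ} (ha : IsModeCoeff a) {w : ℝ} (hw : 0 < w)
    (b : Module.Basis (Fin 3) ℝ Space3) {g : ℝ → ℂ} (hg : IsBoundedAway g) :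
    IsModeCoeff fun k => g (modeFreq w b k) * a k := by
  obtain ⟨M, hM⟩ := hg.exists_modeFreq_bound hw b one_pos
  refine ha.mul_of_norm_le (m := fun k => g (modeFreq w b k)) (D := M) (M := 0) fun k hk => ?_
  simpa using hM 1 le_rfl k hk

/-- Every solution is the sum of its spatial mean and of a superposition of modes. -/
theorem IsConformalSolution.exists_expansion {w c : ℝ} (hw : 0 < w)
    {b : Module.Basis (Fin 3) ℝ Space3} {u : ℝ → Space3 → ℝ} (hu : IsConformalSolution w c b u)
    {h h₁ : ℝ → ℂ} (H : IsModeFunction c h h₁)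
    (hW : ∀ z : ℝ, 0 < z → h z * star (h₁ z) - h₁ z * star (h z) = -2 * Complex.I) :
    ∃ α β : (Fin 3 → ℤ) → ℂ, IsModeCoeff α ∧ IsModeCoeff β ∧ ∀ η : ℝ, 0 < η → ∀ x,
      u η x = (latticeCoeff b (fun x => (u η x : ℂ)) 0).re + realModeSeries w b h α β η x := by
  obtain ⟨u₁, hs₁, hode⟩ := hu.coeff_equation hw
  have hs := hu.toIsSmoothOnTorus
  have r0 := (isRapidlyDecaying_latticeCoeff (hs.periodic_ofReal one_pos)
    (hs.contDiff_ofReal one_pos)).removeZero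
  have r1 := (isRapidlyDecaying_latticeCoeff (hs₁.periodic_ofReal one_pos)
    (hs₁.contDiff_ofReal one_pos)).removeZero.modeFreq_inv_mul hw b
  have B : ∀ {g : ℝ → ℂ}, IsBoundedAway g → ∀ z : ℂ, IsBoundedAway fun t => g t / z := by
    intro g hg z δ hδ
    obtain ⟨M, hM⟩ := hg δ hδ
    refine ⟨M / ‖z‖, fun t ht => ?_⟩
    rw [norm_div]
    gcongr
    exact hM t ht
  -- These are the amplitudes of `eq_combination_of_modeEquation`, with the zero mode of the data at
  -- `η = 1` removed.
  have hα := (r0.profile_mul hw b (B H.conj.isBoundedAway_snd (-2 * Complex.I))).add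
    (r1.profile_mul hw b (B H.conj.isBoundedAway_fst (2 * Complex.I)))
  have hβ := (r0.profile_mul hw b (B H.isBoundedAway_snd (2 * Complex.I))).add
    (r1.profile_mul hw b (B H.isBoundedAway_fst (-2 * Complex.I)))
  refine ⟨_, _, hα, hβ, fun η hη x => ?_⟩
  have s1 := (summable_modeTerm hw b H.isBoundedAway_fst hα hη x).hasSum
  have s2 := (summable_modeTerm hw b H.conj.isBoundedAway_fst hβ hη x).hasSum
  have s3 := hasSum_latticeCoeff (hs.periodic_ofReal hη) (hs.contDiff_ofReal hη) x
  -- The Fourier series of `u` and the mode series agree term by term for `k ≠ 0`, so their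
  -- difference is the single zero mode.
  have s4 := (s3.sub (s1.add s2)).unique (hasSum_single 0 fun k hk => ?_)
  · simp only [planeWave_zero_left, if_true, mul_zero, add_zero, zero_mul, mul_one, sub_zero] at s4
    have s5 := congrArg Complex.re s4
    rw [Complex.sub_re, Complex.ofReal_re] at s5
    simp only [realModeSeries, modeSeries]
    linarith
  · have := eq_combination_of_modeEquation H hW (modeFreq_pos hw b hk)
      (fun η hη => (hode k η hη).1) (fun η hη => (hode k η hη).2) hη
    simp only [hk, if_false]
    rw [this]
    ring

/-! ### Late-time asymptotics -/

theorem realModeSeries_sub {c c' : ℝ} {h h₁ g g₁ : ℝ → ℂ} (H : IsModeFunction c h h₁)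
    (G : IsModeFunction c' g g₁) {w : ℝ} (hw : 0 < w) (b : Module.Basis (Fin 3) ℝ Space3)
    {α β : (Fin 3 → ℤ) → ℂ} (hα : IsModeCoeff α) (hβ : IsModeCoeff β) {η : ℝ} (hη : 0 < η)
    (x : Space3) :
    realModeSeries w b h α β η x - realModeSeries w b g α β η x =
      realModeSeries w b (fun z => h z - g z) α β η x := by
  have key : ∀ {h h₁ g g₁ : ℝ → ℂ} (H : IsModeFunction c h h₁) (G : IsModeFunction c' g g₁)
      {a : (Fin 3 → ℤ) → ℂ} (ha : IsModeCoeff a), modeSeries w b (fun z => h z - g z) a η x =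
        modeSeries w b h a η x - modeSeries w b g a η x := by
    intro h h₁ g g₁ H G a ha
    unfold modeSeries
    rw [← (summable_modeTerm hw b H.isBoundedAway_fst ha hη x).tsum_sub
      (summable_modeTerm hw b G.isBoundedAway_fst ha hη x)]
    exact tsum_congr fun k => by ring
  have k1 := key H G hα
  have k2 := key H.conj G.conj hβ
  simp only [realModeSeries, star_sub, k1, k2, Complex.add_re, Complex.sub_re]
  ring

theorem contDiff_modeSeries_slice {w : ℝ} (b : Module.Basis (Fin 3) ℝ Space3)
    {g : ℝ → ℂ} {a : (Fin 3 → ℤ) → ℂ} (ha : IsModeCoeff a) {η B : ℝ}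
    (hB : ∀ k, k ≠ 0 → ‖g (modeFreq w b k * η)‖ ≤ B) :
    ContDiff ℝ ∞ (modeSeries w b g a η) :=
  contDiff_tsum (N := ⊤) (fun _ => contDiff_const.mul (contDiff_planeWave b _))
    (fun m _ => (ha.summable_waveCovector_pow b m).mul_left B)
    fun m k x _ => norm_iteratedFDeriv_modeTerm_le b ha hB m k x

theorem norm_iteratedFDeriv_realModeSeries_le {w : ℝ} (b : Module.Basis (Fin 3) ℝ Space3)
    {g : ℝ → ℂ} {α β : (Fin 3 → ℤ) → ℂ} (hα : IsModeCoeff α) (hβ : IsModeCoeff β) {η B : ℝ}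
    (hB : ∀ k, k ≠ 0 → ‖g (modeFreq w b k * η)‖ ≤ B) (m : ℕ) (x : Space3) :
    ‖iteratedFDeriv ℝ m (realModeSeries w b g α β η) x‖ ≤
      B * (∑' k, ‖α k‖ * ‖waveCovector b k‖ ^ m + ∑' k, ‖β k‖ * ‖waveCovector b k‖ ^ m) := by
  have hB' : ∀ k, k ≠ 0 → ‖star (g (modeFreq w b k * η))‖ ≤ B := fun k hk => by
    rw [norm_star]; exact hB k hk
  have hm : (m : WithTop ℕ∞) ≤ ∞ := WithTop.coe_le_coe.2 (le_top : (m : ℕ∞) ≤ ⊤)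
  have c1 : ContDiffAt ℝ m (modeSeries w b g α η) x :=
    ((contDiff_modeSeries_slice b hα hB).of_le hm).contDiffAt
  have c2 : ContDiffAt ℝ m (modeSeries w b (fun z => star (g z)) β η) x :=
    ((contDiff_modeSeries_slice b hβ (g := fun z => star (g z)) hB').of_le hm).contDiffAt
  have h1 := Complex.reCLM.norm_iteratedFDeriv_comp_left (c1.add c2) le_rfl
  rw [Complex.reCLM_norm, one_mul] at h1
  refine h1.trans ?_
  refine (congrArg norm (iteratedFDeriv_add_apply c1 c2)).trans_le ((norm_add_le _ _).trans ?_)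
  rw [mul_add]
  exact add_le_add (norm_iteratedFDeriv_modeSeries_le b hα hB m x)
    (norm_iteratedFDeriv_modeSeries_le b hβ (g := fun z => star (g z)) hB' m x)

/-- The remainder is exactly `η^(-ν-1/2)` times the mode series with profile `h - g`. Its profile is
`O(1/η)` uniformly in the mode, which supplies the missing power of `η`. -/
theorem hasLateTimeExpansion_of_modeSeries {c c' : ℝ} {h h₁ g g₁ : ℝ → ℂ}
    (H : IsModeFunction c h h₁) (G : IsModeFunction c' g g₁)
    (hgh : ∀ δ : ℝ, 0 < δ → ∃ M : ℝ, ∀ z : ℝ, δ ≤ z → ‖h z - g z‖ ≤ M / z)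
    {w : ℝ} (hw : 0 < w) {b : Module.Basis (Fin 3) ℝ Space3}
    {α β : (Fin 3 → ℤ) → ℂ} (hα : IsModeCoeff α) (hβ : IsModeCoeff β) {ν A B : ℝ}
    {Φ W : ℝ → Space3 → ℝ}
    (hΦ : ∀ η : ℝ, 0 < η → ∀ x, Φ η x =
      A + η ^ (-ν - 1 / 2) * realModeSeries w b h α β η x + B * η ^ (-2 * ν))
    (hW : ∀ η : ℝ, 0 < η → ∀ x, W η x = realModeSeries w b g α β η x) :
    HasLateTimeExpansion ν Φ A B W := by
  intro m
  obtain ⟨δ, hδ, hω⟩ := exists_le_modeFreq hw b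
  obtain ⟨M, hM⟩ := hgh δ hδ
  set S := ∑' k, ‖α k‖ * ‖waveCovector b k‖ ^ m + ∑' k, ‖β k‖ * ‖waveCovector b k‖ ^ m with hS
  have hM0 : 0 ≤ M := by
    have h1 := (norm_nonneg _).trans (hM δ le_rfl)
    by_contra hneg
    exact absurd h1 (not_le.2 (div_neg_of_neg_of_pos (not_le.1 hneg) hδ))
  refine ⟨M / δ * S, (eventually_ge_atTop 1).mono fun η hη x => ?_⟩
  have hη0 : 0 < η := one_pos.trans_le hη
  -- Here `δ` is the lowest nonzero frequency; `η ≥ 1` puts every argument in `[δ, ∞)`, where the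
  -- single constant `M` is valid.
  have hB : ∀ k, k ≠ 0 → ‖(fun z => h z - g z) (modeFreq w b k * η)‖ ≤ M / δ / η := by
    intro k hk
    have h1 : δ ≤ modeFreq w b k := hω k hk
    have h2 : δ * η ≤ modeFreq w b k * η := by gcongr
    refine (hM _ (le_trans (le_mul_of_one_le_right hδ.le hη) h2)).trans ?_
    rw [div_div]
    gcongr
  set D := realModeSeries w b (fun z => h z - g z) α β η with hD
  have hm : (m : WithTop ℕ∞) ≤ ∞ := WithTop.coe_le_coe.2 (le_top : (m : ℕ∞) ≤ ⊤)
  have eW : W η = realModeSeries w b g α β η := funext (hW η hη0)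
  have cW : ContDiffAt ℝ m (W η) x := by
    rw [eW]
    exact ((contDiff_slice (isConformalSolution_realModeSeries G hw b hα hβ).smooth hη0).of_le
      hm).contDiffAt
  have eD : D = realModeSeries w b h α β η - realModeSeries w b g α β η :=
    funext fun x => (realModeSeries_sub H G hw b hα hβ hη0 x).symm
  have cD : ContDiffAt ℝ m D x := by
    rw [eD]
    exact ((((contDiff_slice (isConformalSolution_realModeSeries H hw b hα hβ).smooth hη0)).sub
      (contDiff_slice (isConformalSolution_realModeSeries G hw b hα hβ).smooth hη0)).of_le
      hm).contDiffAt
  have eΦ : Φ η = (fun _ : Space3 => A) + η ^ (-ν - 1 / 2) • W η +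
      η ^ (-2 * ν) • (fun _ : Space3 => B) + η ^ (-ν - 1 / 2) • D := by
    funext y
    simp only [Pi.add_apply, Pi.smul_apply, smul_eq_mul, hΦ η hη0 y, eD, eW, Pi.sub_apply]
    ring
  have cA : ContDiffAt ℝ m (fun _ : Space3 => A) x := contDiffAt_const
  have cB : ContDiffAt ℝ m (fun _ : Space3 => B) x := contDiffAt_const
  have cW' : ContDiffAt ℝ m (η ^ (-ν - 1 / 2) • W η) x := contDiffAt_const.smul cW
  have cB' : ContDiffAt ℝ m (η ^ (-2 * ν) • (fun _ : Space3 => B)) x := contDiffAt_const.smul cB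
  have cD' : ContDiffAt ℝ m (η ^ (-ν - 1 / 2) • D) x := contDiffAt_const.smul cD
  have cAW : ContDiffAt ℝ m ((fun _ : Space3 => A) + η ^ (-ν - 1 / 2) • W η) x := cA.add cW'
  have cAWB : ContDiffAt ℝ m ((fun _ : Space3 => A) + η ^ (-ν - 1 / 2) • W η +
    η ^ (-2 * ν) • (fun _ : Space3 => B)) x := cAW.add cB'
  rw [eΦ, iteratedFDeriv_add_apply cAWB cD', iteratedFDeriv_add_apply cAW cB', iteratedFDeriv_add_apply cA cW',
    iteratedFDeriv_const_smul_apply cW, iteratedFDeriv_const_smul_apply cB,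
    iteratedFDeriv_const_smul_apply cD, add_sub_cancel_left, norm_smul,
    Real.norm_of_nonneg (by positivity)]
  calc η ^ (-ν - 1 / 2) * ‖iteratedFDeriv ℝ m D x‖
      ≤ η ^ (-ν - 1 / 2) * (M / δ / η * S) := by
        gcongr
        exact norm_iteratedFDeriv_realModeSeries_le b hα hβ hB m x
    _ = M / δ * S * η ^ (-ν - 3 / 2) := by
        rw [show -ν - 3 / 2 = -ν - 1 / 2 - 1 by ring, Real.rpow_sub_one hη0.ne']
        ring

/-! ### Rescaling by powers of the time -/

theorem hasDerivAt_rpow_mul {s η : ℝ} (hη : 0 < η) {u : ℝ → ℝ} {u' : ℝ} (hu : HasDerivAt u u' η) :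
    HasDerivAt (fun η => η ^ s * u η) (η ^ s * u' + s * η ^ (s - 1) * u η) η :=
  ((Real.hasDerivAt_rpow_const (Or.inl hη.ne')).mul hu).congr_deriv (by ring)

theorem hasDerivAt_rpow_mul_two {s η : ℝ} (hη : 0 < η) {u u₁ : ℝ → ℝ} {u₂ : ℝ}
    (hu : HasDerivAt u (u₁ η) η) (hu₁ : HasDerivAt u₁ u₂ η) :
    HasDerivAt (fun η => η ^ s * u₁ η + s * η ^ (s - 1) * u η)
      (η ^ s * (u₂ + 2 * s / η * u₁ η + s * (s - 1) / η ^ 2 * u η)) η := by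
  have h1 := (hasDerivAt_rpow_mul (s := s) hη hu₁).add
    ((hasDerivAt_rpow_mul (s := s - 1) hη hu).const_mul s)
  refine (h1.congr_of_eventuallyEq (Eventually.of_forall fun y => ?_)).congr_deriv ?_
  · simp only [Pi.add_apply]
    ring
  · simp only [Real.rpow_sub_one hη.ne']
    field_simp
    ring

theorem contDiffOn_rpow_time (s : ℝ) :
    ContDiffOn ℝ ∞ (fun p : ℝ × Space3 => p.1 ^ s) (Ioi (0 : ℝ) ×ˢ univ) :=
  contDiffOn_fst.rpow_const_of_ne fun _ hp => (ne_of_gt hp.1)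

theorem IsSmoothOnTorus.rpow_mul {b : Module.Basis (Fin 3) ℝ Space3} {u : ℝ → Space3 → ℝ}
    (hu : IsSmoothOnTorus b u) (s : ℝ) : IsSmoothOnTorus b (fun η x => η ^ s * u η x) where
  smooth := (contDiffOn_rpow_time s).mul hu.smooth
  periodic η hη x i := by rw [hu.periodic η hη x i]

theorem laplacian_const_mul_slice {f : Space3 → ℝ} (hf : ContDiff ℝ ∞ f) (r : ℝ) (x : Space3) :
    Δ (fun x => r * f x) x = r * Δ f x :=
  ContDiffAt.laplacian_CLM_comp_left (l := r • ContinuousLinearMap.id ℝ ℝ)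
    (hf.of_le two_le_infty).contDiffAt

theorem two_mul_lateTimeExponent_add_one {w : ℝ} (hw : 0 < w) :
    2 * lateTimeExponent w + 1 = 6 * (1 + w) / (1 + 3 * w) := by
  unfold lateTimeExponent
  field_simp
  ring

/-- For `s = ν + 1/2`, the factor `2s` equals the damping coefficient and `s(s-1) = ν² - 1/4`. -/
theorem IsPerturbationSolution.rescale {w : ℝ} (hw : 0 < w) {b : Module.Basis (Fin 3) ℝ Space3}
    {Φ : ℝ → Space3 → ℝ} (hΦ : IsPerturbationSolution w b Φ) :
    IsConformalSolution w (lateTimeExponent w ^ 2 - 1 / 4) b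
      (fun η x => η ^ (lateTimeExponent w + 1 / 2) * Φ η x) := by
  have hs := hΦ.toIsSmoothOnTorus
  obtain ⟨u₁, hs₁, hd₁⟩ := hs.exists_timeDeriv
  obtain ⟨u₂, -, hd₂⟩ := hs₁.exists_timeDeriv
  refine ⟨hs.rpow_mul _, fun η hη x => ?_⟩
  have heq := hΦ.equation η hη x
  rw [iteratedDeriv_two_eq hη (fun s hs => hd₁ s hs x) (hd₂ η hη x), (hd₁ η hη x).deriv,
    ← two_mul_lateTimeExponent_add_one hw] at heq
  rw [iteratedDeriv_two_eq hη (fun s hs => hasDerivAt_rpow_mul hs (hd₁ s hs x))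
    (hasDerivAt_rpow_mul_two hη (hd₁ η hη x) (hd₂ η hη x)),
    laplacian_const_mul_slice (contDiff_slice hs.smooth hη)]
  linear_combination η ^ (lateTimeExponent w + 1 / 2) * heq

/-- Inverse of the rescaling; `1` and `η^(-2ν)` are the spatially homogeneous solutions of (∗), as
`p(p-1) + (2ν+1)p = p(p+2ν)`. -/
theorem isPerturbationSolution_of_conformal {w : ℝ} (hw : 0 < w)
    {b : Module.Basis (Fin 3) ℝ Space3} {u : ℝ → Space3 → ℝ}
    (hu : IsConformalSolution w (lateTimeExponent w ^ 2 - 1 / 4) b u) (A B : ℝ) :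
    IsPerturbationSolution w b (fun η x => A + η ^ (-lateTimeExponent w - 1 / 2) * u η x +
      B * η ^ (-2 * lateTimeExponent w)) := by
  have hs := hu.toIsSmoothOnTorus
  obtain ⟨u₁, hs₁, hd₁⟩ := hs.exists_timeDeriv
  obtain ⟨u₂, -, hd₂⟩ := hs₁.exists_timeDeriv
  set ν := lateTimeExponent w with hν
  have hr := hs.rpow_mul (-ν - 1 / 2)
  refine ⟨⟨(contDiffOn_const.add hr.smooth).add (contDiffOn_const.mul (contDiffOn_rpow_time _)),
    fun η hη x i => by rw [hs.periodic η hη x i]⟩, fun η hη x => ?_⟩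
  have d1 : ∀ s : ℝ, 0 < s → HasDerivAt (fun η => A + η ^ (-ν - 1 / 2) * u η x + B * η ^ (-2 * ν))
      ((s ^ (-ν - 1 / 2) * u₁ s x + (-ν - 1 / 2) * s ^ (-ν - 1 / 2 - 1) * u s x) +
        B * (-2 * ν * s ^ (-2 * ν - 1))) s := fun s hs =>
    ((hasDerivAt_rpow_mul hs (hd₁ s hs x)).const_add A).add
      ((Real.hasDerivAt_rpow_const (Or.inl hs.ne')).const_mul B)
  have d2 : HasDerivAt (fun s =>
      (s ^ (-ν - 1 / 2) * u₁ s x + (-ν - 1 / 2) * s ^ (-ν - 1 / 2 - 1) * u s x) +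
        B * (-2 * ν * s ^ (-2 * ν - 1))) _ η :=
    (hasDerivAt_rpow_mul_two hη (hd₁ η hη x) (hd₂ η hη x)).add
      (((Real.hasDerivAt_rpow_const (Or.inl hη.ne')).const_mul (-2 * ν)).const_mul B)
  have hlap : Δ (fun x => A + η ^ (-ν - 1 / 2) * u η x + B * η ^ (-2 * ν)) x =
      η ^ (-ν - 1 / 2) * Δ (u η) x := by
    have c1 : ContDiffAt ℝ 2 (fun x => η ^ (-ν - 1 / 2) * u η x) x :=
      ((contDiff_slice (u := fun η x => η ^ (-ν - 1 / 2) * u η x) hr.smooth hη).of_le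
        two_le_infty).contDiffAt
    have cA : ContDiffAt ℝ 2 (fun _ : Space3 => A + B * η ^ (-2 * ν)) x := contDiffAt_const
    have e : (fun x => A + η ^ (-ν - 1 / 2) * u η x + B * η ^ (-2 * ν)) =
        (fun _ : Space3 => A + B * η ^ (-2 * ν)) + fun x => η ^ (-ν - 1 / 2) * u η x := by
      funext y
      simp only [Pi.add_apply]
      ring
    rw [e, cA.laplacian_add c1, InnerProductSpace.laplacian_const,
      laplacian_const_mul_slice (contDiff_slice hs.smooth hη)]
    simp
  have heq := hu.equation η hη x
  rw [iteratedDeriv_two_eq hη (fun s hs => hd₁ s hs x) (hd₂ η hη x)] at heq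
  rw [iteratedDeriv_two_eq hη d1 d2, (d1 η hη).deriv, hlap,
    ← two_mul_lateTimeExponent_add_one hw, ← hν]
  simp only [Real.rpow_sub_one hη.ne']
  have hη' := hη.ne'
  linear_combination (norm := skip) η ^ (-ν - 1 / 2) * heq
  field_simp
  ring

/-- Equivalent to `w ≤ 1`. It ensures `ν² - 1/4 ≥ 0`, as the Picard majorants require. -/
theorem one_le_lateTimeExponent {w : ℝ} (hw0 : 0 < w) (hw1 : w ≤ 1) : 1 ≤ lateTimeExponent w := by
  unfold lateTimeExponent
  have h : 0 < 1 + 3 * w := by positivity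
  rw [one_div, inv_mul_eq_div, le_div_iff₀ (by norm_num), le_div_iff₀ h]
  linarith

/-- A solution of the flat wave equation with zero mean is a superposition of modes. -/
theorem IsFlatWaveSolution.exists_expansion {w : ℝ} (hw : 0 < w)
    {b : Module.Basis (Fin 3) ℝ Space3} {W : ℝ → Space3 → ℝ} (hW : IsFlatWaveSolution w b W)
    (h0 : HasZeroSpatialMean b W) :
    ∃ α β : (Fin 3 → ℤ) → ℂ, IsModeCoeff α ∧ IsModeCoeff β ∧ ∀ η : ℝ, 0 < η → ∀ x,
      W η x = realModeSeries w b (fun z : ℝ => Complex.exp (z * Complex.I)) α β η x := by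
  -- For `c = 0` the exponential is itself the outgoing solution, so the asymptotic error constant
  -- is `0`.
  obtain ⟨α, β, hα, hβ, h⟩ := (isConformalSolution_zero_iff.2 hW).exists_expansion hw
    isModeFunction_exp fun z hz => wronskian_outgoing isModeFunction_exp (M := 0) (by simp) hz
  refine ⟨α, β, hα, hβ, fun η hη x => ?_⟩
  have hs := hW.toIsSmoothOnTorus
  have h1 := setIntegral_of_hasSum_planeWave b
    (isRapidlyDecaying_latticeCoeff (hs.periodic_ofReal hη) (hs.contDiff_ofReal hη)).summable_norm
    (hasSum_latticeCoeff (hs.periodic_ofReal hη) (hs.contDiff_ofReal hη))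
  -- The integral over the cell is its volume times the zeroth coefficient, so vanishing mean
  -- removes the zero mode.
  rw [integral_complex_ofReal, h0 η hη, Complex.ofReal_zero, eq_comm, mul_eq_zero] at h1
  have h2 : (volume (ZSpan.fundamentalDomain b)).toReal ≠ 0 :=
    ENNReal.toReal_ne_zero.2 ⟨ZSpan.measure_fundamentalDomain_ne_zero b,
      (ZSpan.fundamentalDomain_isBounded b).measure_lt_top.ne⟩
  rw [h η hη x, h1.resolve_left (by exact_mod_cast h2)]
  simp

theorem theorem4 (w : ℝ) (hw0 : 0 < w) (hw1 : w ≤ 1) (b : Module.Basis (Fin 3) ℝ Space3) :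
    (∀ Φ : ℝ → Space3 → ℝ, IsPerturbationSolution w b Φ →
      ∃ (A B : ℝ) (W : ℝ → Space3 → ℝ),
        IsFlatWaveSolution w b W ∧ HasZeroSpatialMean b W ∧
          HasLateTimeExpansion (lateTimeExponent w) Φ A B W) ∧
    (∀ (A B : ℝ) (W : ℝ → Space3 → ℝ),
      IsFlatWaveSolution w b W → HasZeroSpatialMean b W →
        ∃ Φ : ℝ → Space3 → ℝ, IsPerturbationSolution w b Φ ∧
          HasLateTimeExpansion (lateTimeExponent w) Φ A B W) := by
  have hν := one_le_lateTimeExponent hw0 hw1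
  obtain ⟨h, h₁, H, hasy⟩ := exists_outgoing_modeFunction
    (c := lateTimeExponent w ^ 2 - 1 / 4) (by nlinarith)
  have hgh : ∀ δ : ℝ, 0 < δ → ∃ M : ℝ, ∀ z : ℝ, δ ≤ z →
      ‖h z - Complex.exp (z * Complex.I)‖ ≤ M / z := fun δ hδ =>
    (hasy δ hδ).imp fun M hM z hz => (hM z hz).1
  refine ⟨fun Φ hΦ => ?_, fun A B W hW h0 => ?_⟩
  · have hu := hΦ.rescale hw0
    obtain ⟨M, hM⟩ := hasy 1 one_pos
    obtain ⟨α, β, hα, hβ, hexp⟩ := hu.exists_expansion hw0 H fun z hz => wronskian_outgoing H hM hz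
    obtain ⟨u₁, -, hode⟩ := hu.coeff_equation hw0
    -- The zero mode has frequency `0`, so its mode equation is the Euler equation.
    obtain ⟨A, B, hAB⟩ := eq_combination_of_eulerEquation (by linarith : 0 < lateTimeExponent w)
      (fun η hη => (hode 0 η hη).1) (fun η hη => by
        have := (hode 0 η hη).2
        have hz : modeFreq w b 0 = 0 := by
          have : waveCovector b 0 = 0 := by simp [waveCovector]
          simp [modeFreq, this]
        rwa [hz, zero_pow two_ne_zero, sub_zero] at this)
    refine ⟨A.re, B.re, realModeSeries w b (fun z : ℝ => Complex.exp (z * Complex.I)) α β,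
      isConformalSolution_zero_iff.1
        (isConformalSolution_realModeSeries isModeFunction_exp hw0 b hα hβ),
      integral_realModeSeries isModeFunction_exp hw0 b hα hβ,
      hasLateTimeExpansion_of_modeSeries H isModeFunction_exp hgh hw0 hα hβ (fun η hη x => ?_)
        fun _ _ _ => rfl⟩
    have h1 := hexp η hη x
    have h2 := congrArg Complex.re (hAB η hη)
    rw [Complex.add_re, Complex.re_mul_ofReal, Complex.re_mul_ofReal] at h2
    rw [h2] at h1
    have e1 : η ^ (-lateTimeExponent w - 1 / 2) * η ^ (lateTimeExponent w + 1 / 2) = 1 := by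
      rw [← Real.rpow_add hη, show -lateTimeExponent w - 1 / 2 + (lateTimeExponent w + 1 / 2) =
        (0 : ℝ) by ring, Real.rpow_zero]
    have e2 : η ^ (-lateTimeExponent w - 1 / 2) * η ^ (-lateTimeExponent w + 1 / 2) =
        η ^ (-2 * lateTimeExponent w) := by
      rw [← Real.rpow_add hη]
      congr 1
      ring
    linear_combination η ^ (-lateTimeExponent w - 1 / 2) * h1 + (A.re - Φ η x) * e1 + B.re * e2
  -- The amplitudes of `W` are reused with the profile `h` in place of the exponential.
  · obtain ⟨α, β, hα, hβ, hexp⟩ := hW.exists_expansion hw0 h0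
    exact ⟨_, isPerturbationSolution_of_conformal hw0
      (isConformalSolution_realModeSeries H hw0 b hα hβ) A B,
      hasLateTimeExpansion_of_modeSeries H isModeFunction_exp hgh hw0 hα hβ
        (fun _ _ _ => rfl) hexp⟩
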